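/- Let $H$ and $K$ be real Hilbert spaces. A real $C^*$-algebra is a norm-closed real subalgebra of $B(H)$ that is closed under the adjoint operation; a real $JC^*$-algebra is a norm-closed real linear subspace of $B(H)$ that is closed under the adjoint operation and under squares $a \mapsto a^2$ (no unit is assumed in either case). A real linear map $T : A \to B$ is contractive if $\|T(a)\| \le \|a\|$ for all $a \in A$, selfadjoint if $T(a^*) = T(a)^*$ for all $a \in A$, and positive if it takes every element of $A$ that is a positive operator (selfadjoint with nonnegative quadratic form) to a positive operator. It is completely positive (respectively, completely contractive) if for every $n$ the entrywise amplification $T_n : M_n(A) \to M_n(B)$ is positive (respectively, contractive), where $M_n(A) \subseteq M_n(B(H)) = B(H^n)$ and likewise for $B$. A Jordan homomorphism is a real linear map with $T(ab+ba) = T(a)T(b) + T(b)T(a)$ for all $a, b \in A$. **Theorem.** (1) Let $\pi : A \to B$ be a (real linear) homomorphism between real $C^*$-algebras $A \subseteq B(H)$ and $B \subseteq B(K)$. Then $\pi$ is contractive if and only if it is selfadjoint. In this case $\pi$ is a $*$-homomorphism, and it is positive, indeed completely positive, and completely contractive. (2) Let $\pi : A \to B$ be a Jordan homomorphism between real $JC^*$-algebras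 $A \subseteq B(H)$ and $B \subseteq B(K)$. Then $\pi$ is contractive if and only if it is selfadjoint. In this case $\pi$ is a Jordan $*$-homomorphism, and it is positive. Boundedness of $\pi$ is not assumed in either part. -/

import Mathlib

/-! Real C*-algebras are norm-closed selfadjoint subalgebras of `B(H)`, for a real Hilbert space `H`;
in Lean: `A : NonUnitalStarSubalgebra ℝ (H →L[ℝ] H)` together with `IsClosed (A : Set (H →L[ℝ] H))`.
Algebras need not have a unit. -/

/-- A real JC*-algebra acting on the real Hilbert space `H`: a norm-closed selfadjoint real subspace
of `B(H)` which is closed under squares. -/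
structure RealJCStarAlgebra (H : Type*) [NormedAddCommGroup H] [InnerProductSpace ℝ H]
    [CompleteSpace H] extends Submodule ℝ (H →L[ℝ] H) where
  isClosed' : IsClosed carrier
  star_mem' : ∀ {a : H →L[ℝ] H}, a ∈ carrier → star a ∈ carrier
  sq_mem' : ∀ {a : H →L[ℝ] H}, a ∈ carrier → a * a ∈ carrier

namespace RealJCStarAlgebra

variable {H : Type*} [NormedAddCommGroup H] [InnerProductSpace ℝ H] [CompleteSpace H]

instance : SetLike (RealJCStarAlgebra H) (H →L[ℝ] H) where
  coe A := A.carrier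
  coe_injective A B h := by
    cases A; cases B; congr; exact SetLike.coe_injective h

instance : AddSubgroupClass (RealJCStarAlgebra H) (H →L[ℝ] H) where
  add_mem {A _ _} ha hb := A.toSubmodule.add_mem ha hb
  zero_mem A := A.toSubmodule.zero_mem
  neg_mem {A _} ha := A.toSubmodule.neg_mem ha

instance : SMulMemClass (RealJCStarAlgebra H) ℝ (H →L[ℝ] H) where
  smul_mem {A} r _ ha := A.toSubmodule.smul_mem r ha

instance : StarMemClass (RealJCStarAlgebra H) (H →L[ℝ] H) where
  star_mem {A _} ha := A.star_mem' ha

theorem jordan_mem (A : RealJCStarAlgebra H) {a b : H →L[ℝ] H} (ha : a ∈ A) (hb : b ∈ A) :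
    a * b + b * a ∈ A := by
  have h : a * b + b * a = (a + b) * (a + b) - a * a - b * b := by noncomm_ring
  rw [h]
  exact sub_mem (sub_mem (A.sq_mem' (add_mem ha hb)) (A.sq_mem' ha)) (A.sq_mem' hb)

/-- The (unnormalized) Jordan product `ab + ba` of two elements of a real JC*-algebra. -/
def jordan {A : RealJCStarAlgebra H} (a b : A) : A :=
  ⟨(a : H →L[ℝ] H) * b + b * a, A.jordan_mem a.2 b.2⟩

end RealJCStarAlgebra

section MatrixOperator

variable {H : Type*} [NormedAddCommGroup H] [InnerProductSpace ℝ H]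

/-- The operator on the Hilbert space sum `H ⊕ ⋯ ⊕ H` (`n` summands) given by an `n × n` matrix of
operators on `H`; this is the identification `M_n(B(H)) = B(H^n)`. -/
noncomputable def matrixOperator {n : ℕ} (M : Matrix (Fin n) (Fin n) (H →L[ℝ] H)) :
    PiLp 2 (fun _ : Fin n => H) →L[ℝ] PiLp 2 (fun _ : Fin n => H) :=
  ((PiLp.continuousLinearEquiv 2 ℝ (fun _ : Fin n => H)).symm :
      (∀ _ : Fin n, H) →L[ℝ] PiLp 2 (fun _ : Fin n => H)) ∘L
    ContinuousLinearMap.pi fun i => ∑ j, M i j ∘L PiLp.proj 2 (fun _ : Fin n => H) j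

theorem matrixOperator_apply {n : ℕ} (M : Matrix (Fin n) (Fin n) (H →L[ℝ] H))
    (ξ : PiLp 2 (fun _ : Fin n => H)) (i : Fin n) :
    matrixOperator M ξ i = ∑ j, M i j (ξ j) := by
  simp [matrixOperator]

end MatrixOperator

section Maps

variable {H : Type*} [NormedAddCommGroup H] [InnerProductSpace ℝ H] [CompleteSpace H]
variable {K : Type*} [NormedAddCommGroup K] [InnerProductSpace ℝ K] [CompleteSpace K]

/-- A linear map `T` between real JC*-algebras is a Jordan homomorphism if
`T (ab + ba) = T a T b + T b T a`. -/
def IsJordanHom {A : RealJCStarAlgebra H} {B : RealJCStarAlgebra K} (T : A →ₗ[ℝ] B) : Prop :=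
  ∀ a b : A, T (RealJCStarAlgebra.jordan a b) = RealJCStarAlgebra.jordan (T a) (T b)

variable {S : Type*} [SetLike S (H →L[ℝ] H)] {R : Type*} [SetLike R (K →L[ℝ] K)]
variable {A : S} {B : R}

/-- `T : A → B` is contractive: `‖T a‖ ≤ ‖a‖`, with the operator norms of `B(H)` and `B(K)`. -/
def IsContractiveMap (T : A → B) : Prop :=
  ∀ a : A, ‖(T a : K →L[ℝ] K)‖ ≤ ‖(a : H →L[ℝ] H)‖

/-- `T : A → B` is selfadjoint: `T (a*) = (T a)*`. -/
def IsSelfadjointMap [StarMemClass S (H →L[ℝ] H)] [StarMemClass R (K →L[ℝ] K)] (T : A → B) :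
    Prop :=
  ∀ a : A, T (star a) = star (T a)

/-- `T : A → B` is positive: it maps elements of `A` that are positive operators (selfadjoint, with
nonnegative quadratic form) to positive operators. -/
def IsPositiveMap (T : A → B) : Prop :=
  ∀ a : A, (a : H →L[ℝ] H).IsPositive → (T a : K →L[ℝ] K).IsPositive

/-- `T : A → B` is completely positive: each entrywise amplification `T_n : M_n(A) → M_n(B)` is
positive, where `M_n(A) ⊆ M_n(B(H)) = B(H^n)`. -/
def IsCompletelyPositiveMap (T : A → B) : Prop :=
  ∀ (n : ℕ) (M : Matrix (Fin n) (Fin n) A),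
    (matrixOperator (M.map fun a => (a : H →L[ℝ] H))).IsPositive →
      (matrixOperator (M.map fun a => (T a : K →L[ℝ] K))).IsPositive

/-- `T : A → B` is completely contractive: each entrywise amplification `T_n : M_n(A) → M_n(B)` is
contractive, where `M_n(A) ⊆ M_n(B(H)) = B(H^n)` carries the operator norm. -/
def IsCompletelyContractiveMap (T : A → B) : Prop :=
  ∀ (n : ℕ) (M : Matrix (Fin n) (Fin n) A),
    ‖matrixOperator (M.map fun a => (T a : K →L[ℝ] K))‖ ≤
      ‖matrixOperator (M.map fun a => (a : H →L[ℝ] H))‖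

/-- A Jordan *-homomorphism between real JC*-algebras: a selfadjoint Jordan homomorphism. -/
def IsJordanStarHom {A : RealJCStarAlgebra H} {B : RealJCStarAlgebra K} (T : A →ₗ[ℝ] B) : Prop :=
  IsJordanHom T ∧ IsSelfadjointMap T

end Maps

/-! The implication from contractive to selfadjoint rests on one fact about a contraction `J`: if `J
(J F) = F`, then `J` is isometric on the vectors involved, so equality in Cauchy-Schwarz forces `J*
F = J F` (`star_mul_eq_of_mul_mul_eq`); likewise `J (J F) = -F` forces `J* F = -J F`. Under a
contractive map of a function algebra, functions that take only the values 1 and -1 on the support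
of `f` supply such `J`. A function with values in `[0, N]` is within 1 of a sum of `N` ramps, each
of which is affine in such a sign function away from its climbing intervals. Hence the defect of `N
v` is bounded independently of `N`, and the defect of `v` is zero (`star_mul_eq_of_contractive`).
The functional calculus transfers this to selfadjoint operators. A skew operator `k` is treated
through an approximate polar decomposition over `-k²`, whose phase squares to -1
(`star_map_eq_neg_of_contractive`). Since there is no unit, everything is cut off away from 0 and
recovered up to `ε`. A Jordan homomorphism preserves powers, so a contractive one is multiplicative
on the closed algebra generated by one element, and the selfadjoint and skew parts of `a` can be
treated separately.

Conversely, a selfadjoint Jordan homomorphism preserves squares of selfadjoint elements, hence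
positivity, because square roots stay in the algebra. Positivity of `‖x‖² x² - x⁴` gives
contractivity on selfadjoint elements, and squaring gives it on skew ones, so `‖T a‖ ≤ 2 ‖a‖` in
general. The identity `‖a a* a‖ = ‖a‖³` then removes the factor 2 by iteration
(`norm_map_le_of_jordan_star`). The complete statements follow by applying this to `M_n(A)`, itself
a real JC*-algebra on `H^n`. -/

/-! ### Polynomials in a selfadjoint operator on a real Hilbert space. -/

section FunctionalCalculus

variable {H : Type*} [NormedAddCommGroup H] [InnerProductSpace ℝ H] [CompleteSpace H]

open Polynomial
open scoped InnerProductSpace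

/-- A selfadjoint operator whose quadratic form lies between `a` and `b`. -/
structure HasFormBounds (x : H →L[ℝ] H) (a b : ℝ) : Prop where
  isSelfAdjoint : IsSelfAdjoint x
  lower : ∀ ξ, a * ‖ξ‖ ^ 2 ≤ ⟪x ξ, ξ⟫_ℝ
  upper : ∀ ξ, ⟪x ξ, ξ⟫_ℝ ≤ b * ‖ξ‖ ^ 2

theorem HasFormBounds.of_norm_le {x : H →L[ℝ] H} (hx : IsSelfAdjoint x) {r : ℝ} (h : ‖x‖ ≤ r) :
    HasFormBounds x (-r) r := by
  have key : ∀ ξ, |⟪x ξ, ξ⟫_ℝ| ≤ r * ‖ξ‖ ^ 2 := fun ξ => by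
    calc |⟪x ξ, ξ⟫_ℝ| ≤ ‖x ξ‖ * ‖ξ‖ := abs_real_inner_le_norm _ _
      _ ≤ (r * ‖ξ‖) * ‖ξ‖ := by gcongr; exact x.le_of_opNorm_le h ξ
      _ = r * ‖ξ‖ ^ 2 := by ring
  exact ⟨hx, fun ξ => by linarith [neg_abs_le ⟪x ξ, ξ⟫_ℝ, key ξ],
    fun ξ => (le_abs_self _).trans (key ξ)⟩

theorem HasFormBounds.of_isPositive {x : H →L[ℝ] H} (hx : x.IsPositive) {r : ℝ} (h : ‖x‖ ≤ r) :
    HasFormBounds x 0 r :=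
  ⟨hx.isSelfAdjoint, fun ξ => by simpa using hx.inner_nonneg_left ξ,
    (HasFormBounds.of_norm_le hx.isSelfAdjoint h).upper⟩

theorem isSelfAdjoint_inner_comm {x : H →L[ℝ] H} (hx : IsSelfAdjoint x) (ξ η : H) :
    ⟪x ξ, η⟫_ℝ = ⟪ξ, x η⟫_ℝ := hx.isSymmetric ξ η

theorem isUnit_of_form_coercive {f : H →L[ℝ] H} {c : ℝ} (hc : 0 < c)
    (h : ∀ ξ, c * ‖ξ‖ ^ 2 ≤ |⟪f ξ, ξ⟫_ℝ|) : IsUnit f :=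
  ContinuousLinearMap.isUnit_of_forall_le_norm_inner_map f (c := ⟨c, hc.le⟩) hc fun ξ => by
    rw [mul_comm]; exact h ξ

theorem isSelfAdjoint_aeval {x : H →L[ℝ] H} (hx : IsSelfAdjoint x) (p : ℝ[X]) :
    IsSelfAdjoint (aeval x p) := by
  induction p using Polynomial.induction_on' with
  | add p q hp hq => simpa using hp.add hq
  | monomial n c =>
    rw [← C_mul_X_pow_eq_monomial, ← smul_eq_C_mul, map_smul, map_pow, aeval_X]
    exact (IsSelfAdjoint.all c).smul (hx.pow n)

omit [CompleteSpace H] in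
-- Completing the square: `4A` times the form is `‖2A xξ + Bξ‖²` plus `(4AD - B²)‖ξ‖²`.
theorem abs_form_quadratic_lower (x : H →L[ℝ] H) {A B D : ℝ} (hA : A ≠ 0)
    (ξ : H) : (4 * A * D - B ^ 2) / (4 * |A|) * ‖ξ‖ ^ 2 ≤
      |A * ‖x ξ‖ ^ 2 + B * ⟪x ξ, ξ⟫_ℝ + D * ‖ξ‖ ^ 2| := by
  have h1 : ‖(2 * A) • x ξ + B • ξ‖ ^ 2 =
      4 * A ^ 2 * ‖x ξ‖ ^ 2 + 4 * A * B * ⟪x ξ, ξ⟫_ℝ + B ^ 2 * ‖ξ‖ ^ 2 := by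
    rw [norm_add_sq_real, norm_smul, norm_smul, real_inner_smul_left, real_inner_smul_right,
      mul_pow, mul_pow, Real.norm_eq_abs, Real.norm_eq_abs, sq_abs, sq_abs]
    ring
  have hA' : 0 < |A| := abs_pos.2 hA
  rw [div_mul_eq_mul_div, div_le_iff₀ (by positivity)]
  calc (4 * A * D - B ^ 2) * ‖ξ‖ ^ 2
      ≤ 4 * A * (A * ‖x ξ‖ ^ 2 + B * ⟪x ξ, ξ⟫_ℝ + D * ‖ξ‖ ^ 2) := by
        nlinarith [sq_nonneg ‖(2 * A) • x ξ + B • ξ‖]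
    _ ≤ |4 * A * (A * ‖x ξ‖ ^ 2 + B * ⟪x ξ, ξ⟫_ℝ + D * ‖ξ‖ ^ 2)| := le_abs_self _
    _ = _ := by rw [abs_mul, abs_mul]; norm_num; ring

theorem HasFormBounds.affine_lower {x : H →L[ℝ] H} {a b : ℝ} (hx : HasFormBounds x a b)
    {B D c : ℝ} (ha : c ≤ B * a + D) (hb : c ≤ B * b + D) (ξ : H) :
    c * ‖ξ‖ ^ 2 ≤ B * ⟪x ξ, ξ⟫_ℝ + D * ‖ξ‖ ^ 2 := by
  have h0 := sq_nonneg ‖ξ‖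
  rcases le_total 0 B with hB | hB
  · nlinarith [mul_le_mul_of_nonneg_left (hx.lower ξ) hB, mul_le_mul_of_nonneg_right ha h0]
  · nlinarith [mul_le_mul_of_nonpos_left (hx.upper ξ) hB, mul_le_mul_of_nonneg_right hb h0]

/-- Over the reals an irreducible polynomial has degree at most two. A linear one has constant sign
on `[a, b]`, so the form bounds make its value at `x` coercive; a quadratic one has negative
discriminant and is coercive without them. Factorization then handles every polynomial, with no
complexification. -/
theorem HasFormBounds.isUnit_aeval_irreducible {x : H →L[ℝ] H} {a b : ℝ}
    (hx : HasFormBounds x a b) (hab : a ≤ b) {p : ℝ[X]} (hp : Irreducible p)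
    (hroot : ∀ t ∈ Set.Icc a b, p.eval t ≠ 0) : IsUnit (aeval x p) := by
  have hform := eq_quadratic_of_degree_le_two hp.degree_le_two
  set A := p.coeff 2
  set B := p.coeff 1
  set D := p.coeff 0
  have hev : ∀ t, p.eval t = A * t ^ 2 + B * t + D := fun t => by
    rw [hform]; simp
  have hinner : ∀ ξ, ⟪aeval x p ξ, ξ⟫_ℝ = A * ‖x ξ‖ ^ 2 + B * ⟪x ξ, ξ⟫_ℝ + D * ‖ξ‖ ^ 2 := by
    intro ξ
    rw [hform]
    simp only [map_add, map_mul, aeval_C, aeval_X, map_pow, Algebra.algebraMap_eq_smul_one,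
      smul_mul_assoc, one_mul, add_apply, smul_apply,
      inner_add_left, real_inner_smul_left, one_apply_eq_self,
      real_inner_self_eq_norm_sq, pow_two x, mul_apply_eq_comp]
    rw [isSelfAdjoint_inner_comm hx.isSelfAdjoint (x ξ) ξ, real_inner_self_eq_norm_sq]
  by_cases hA : A = 0
  · have hcont : ContinuousOn (fun t => p.eval t) (Set.Icc a b) := p.continuous.continuousOn
    have ha := hroot a ⟨le_rfl, hab⟩
    have hb := hroot b ⟨hab, le_rfl⟩
    rcases lt_or_gt_of_ne ha with ha' | ha' <;> rcases lt_or_gt_of_ne hb with hb' | hb'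
    · refine isUnit_of_form_coercive (c := min (-p.eval a) (-p.eval b))
        (lt_min (by linarith) (by linarith)) fun ξ => ?_
      rw [hinner, ← abs_neg]
      refine le_trans ?_ (le_abs_self _)
      have := hx.affine_lower (B := -B) (D := -D) (c := min (-p.eval a) (-p.eval b))
        ((min_le_left _ _).trans (by rw [hev, hA]; linarith))
        ((min_le_right _ _).trans (by rw [hev, hA]; linarith)) ξ
      rw [hA]; linarith
    · obtain ⟨t, ht, h0⟩ := intermediate_value_Icc hab hcont ⟨ha'.le, hb'.le⟩
      exact absurd h0 (hroot t ht)
    · obtain ⟨t, ht, h0⟩ := intermediate_value_Icc' hab hcont ⟨hb'.le, ha'.le⟩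
      exact absurd h0 (hroot t ht)
    · refine isUnit_of_form_coercive (c := min (p.eval a) (p.eval b)) (lt_min ha' hb') fun ξ => ?_
      rw [hinner]
      refine le_trans ?_ (le_abs_self _)
      have := hx.affine_lower (B := B) (D := D) (c := min (p.eval a) (p.eval b))
        ((min_le_left _ _).trans (by rw [hev, hA]; linarith))
        ((min_le_right _ _).trans (by rw [hev, hA]; linarith)) ξ
      rw [hA]; linarith
  · have hdisc : 0 < 4 * A * D - B ^ 2 := by
      by_contra! hneg
      obtain ⟨t, ht⟩ := exists_quadratic_eq_zero (a := A) (b := B) (c := D) hA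
        ⟨√(B ^ 2 - 4 * A * D), by rw [discrim, Real.mul_self_sqrt (by linarith)]⟩
      have h1 := degree_eq_one_of_irreducible_of_root hp
        (show p.IsRoot t by rw [IsRoot, hev]; linarith)
      exact hA (coeff_eq_zero_of_degree_lt (by rw [h1]; norm_num))
    refine isUnit_of_form_coercive (c := (4 * A * D - B ^ 2) / (4 * |A|))
      (div_pos hdisc (by positivity)) fun ξ => ?_
    rw [hinner]
    exact abs_form_quadratic_lower x hA ξ

theorem HasFormBounds.isUnit_aeval {x : H →L[ℝ] H} {a b : ℝ} (hx : HasFormBounds x a b)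
    (hab : a ≤ b) (q : ℝ[X]) (hq : ∀ t ∈ Set.Icc a b, q.eval t ≠ 0) : IsUnit (aeval x q) := by
  induction q using WfDvdMonoid.induction_on_irreducible with
  | zero => exact absurd (by simp) (hq a ⟨le_rfl, hab⟩)
  | unit u hu => exact hu.map (aeval x)
  | mul q p hq0' hp ih =>
    rw [map_mul]
    exact (hx.isUnit_aeval_irreducible hab hp fun t ht h => hq t ht (by simp [h])).mul
      (ih fun t ht h => hq t ht (by simp [h]))

/-- Real form of the fact that the norm or its negative lies in the spectrum: an inverse would bound
`‖y‖² - y²` below, and then `‖y ξ‖²` would stay under a constant strictly smaller than `‖y‖²` on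
unit vectors. -/
theorem not_isUnit_norm_sq_sub_sq {y : H →L[ℝ] H} (hy : IsSelfAdjoint y) (hy0 : y ≠ 0) :
    ¬ IsUnit (algebraMap ℝ (H →L[ℝ] H) (‖y‖ ^ 2) - y * y) := by
  rintro ⟨u, hu⟩
  set N := ‖y‖
  have hN : 0 < N := norm_pos_iff.2 hy0
  have hbound : ∀ ξ, ‖ξ‖ ≤ ‖(↑u⁻¹ : H →L[ℝ] H)‖ * ‖(u : H →L[ℝ] H) ξ‖ := fun ξ => by
    have : (↑u⁻¹ : H →L[ℝ] H) ((u : H →L[ℝ] H) ξ) = ξ := by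
      rw [← mul_apply_eq_comp, Units.inv_mul, one_apply_eq_self]
    calc ‖ξ‖ = ‖(↑u⁻¹ : H →L[ℝ] H) ((u : H →L[ℝ] H) ξ)‖ := by rw [this]
      _ ≤ _ := ContinuousLinearMap.le_opNorm _ _
  set M := ‖(↑u⁻¹ : H →L[ℝ] H)‖
  have hM : 0 ≤ M := norm_nonneg _
  have hsq : ∀ ξ, ‖(u : H →L[ℝ] H) ξ‖ ^ 2 ≤ 2 * N ^ 2 * (N ^ 2 * ‖ξ‖ ^ 2 - ‖y ξ‖ ^ 2) := by
    intro ξ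
    have h1 : (u : H →L[ℝ] H) ξ = N ^ 2 • ξ - y (y ξ) := by
      rw [hu]; simp [Algebra.algebraMap_eq_smul_one]
    rw [h1, norm_sub_sq_real, real_inner_smul_left, ← isSelfAdjoint_inner_comm hy,
      real_inner_self_eq_norm_sq, norm_smul, mul_pow, Real.norm_eq_abs, sq_abs]
    have h2 : ‖y (y ξ)‖ ≤ N * ‖y ξ‖ := y.le_opNorm _
    have h3 : ‖y ξ‖ ≤ N * ‖ξ‖ := y.le_opNorm _
    have h4 : ‖y (y ξ)‖ ^ 2 ≤ N ^ 2 * ‖y ξ‖ ^ 2 := by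
      rw [← mul_pow]; gcongr
    have h5 : ‖y ξ‖ ^ 2 ≤ N ^ 2 * ‖ξ‖ ^ 2 := by
      rw [← mul_pow]; gcongr
    nlinarith [mul_le_mul_of_nonneg_left h5 (sq_nonneg N)]
  -- The `+ 1` keeps the denominator positive without showing that the inverse is nonzero.
  set δ := 1 / (2 * N ^ 2 * (M ^ 2 + 1))
  have hδ : 0 < δ := by positivity
  have hyξ : ∀ ξ, ‖y ξ‖ ^ 2 ≤ (N ^ 2 - δ) * ‖ξ‖ ^ 2 := fun ξ => by
    have h1 : ‖ξ‖ ^ 2 ≤ M ^ 2 * ‖(u : H →L[ℝ] H) ξ‖ ^ 2 := by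
      rw [← mul_pow]; exact pow_le_pow_left₀ (norm_nonneg _) (hbound ξ) 2
    have h2 : ‖ξ‖ ^ 2 ≤ (M ^ 2 + 1) * (2 * N ^ 2 * (N ^ 2 * ‖ξ‖ ^ 2 - ‖y ξ‖ ^ 2)) := by
      nlinarith [mul_le_mul_of_nonneg_left (hsq ξ) (by positivity : 0 ≤ M ^ 2 + 1),
        sq_nonneg ‖(u : H →L[ℝ] H) ξ‖]
    have h3 : δ * ‖ξ‖ ^ 2 ≤ N ^ 2 * ‖ξ‖ ^ 2 - ‖y ξ‖ ^ 2 := by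
      rw [div_mul_eq_mul_div, one_mul, div_le_iff₀ (by positivity)]
      linarith
    linarith
  have hN' : N ≤ √(max (N ^ 2 - δ) 0) := by
    refine ContinuousLinearMap.opNorm_le_bound _ (Real.sqrt_nonneg _) fun ξ => ?_
    refine abs_le_of_sq_le_sq' ?_ (by positivity) |>.2
    rw [mul_pow, Real.sq_sqrt (le_max_right _ _)]
    exact (hyξ ξ).trans (by gcongr; exact le_max_left _ _)
  have h1 : N ^ 2 ≤ max (N ^ 2 - δ) 0 := by
    rw [← Real.sq_sqrt (le_max_right (N ^ 2 - δ) 0)]; gcongr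
  rcases le_max_iff.1 h1 with h | h
  · linarith
  · nlinarith

/-- If `‖p(x)‖` exceeded the supremum of `|p|`, then `‖p(x)‖² - p²` would have no zero on `[a, b]`
and so would be invertible at `x`, against `not_isUnit_norm_sq_sub_sq`. -/
theorem HasFormBounds.norm_aeval_le {x : H →L[ℝ] H} {a b : ℝ} (hx : HasFormBounds x a b)
    (hab : a ≤ b) (p : ℝ[X]) : ‖aeval x p‖ ≤ ‖p.toContinuousMapOnAlgHom (Set.Icc a b)‖ := by
  set y := aeval x p with hy
  by_contra! hlt
  have hy0 : y ≠ 0 := norm_pos_iff.1 ((norm_nonneg _).trans_lt hlt)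
  refine not_isUnit_norm_sq_sub_sq (isSelfAdjoint_aeval hx.isSelfAdjoint p) hy0 ?_
  have : algebraMap ℝ (H →L[ℝ] H) (‖y‖ ^ 2) - y * y = aeval x (C (‖y‖ ^ 2) - p * p) := by
    simp [hy]
  rw [this]
  refine hx.isUnit_aeval hab _ fun t ht h0 => ?_
  have h1 : ‖p.eval t‖ ≤ ‖p.toContinuousMapOnAlgHom (Set.Icc a b)‖ :=
    ContinuousMap.norm_coe_le_norm (p.toContinuousMapOnAlgHom (Set.Icc a b)) ⟨t, ht⟩
  have h2 : ‖p.eval t‖ ^ 2 < ‖y‖ ^ 2 := by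
    have := h1.trans_lt hlt
    gcongr
  rw [Real.norm_eq_abs, sq_abs] at h2
  simp at h0
  nlinarith

end FunctionalCalculus

/-! ### Continuous functional calculus without a unit. -/

section ContinuousFunctionalCalculus

open Polynomial
open scoped InnerProductSpace

variable {H : Type*} [NormedAddCommGroup H] [InnerProductSpace ℝ H] [CompleteSpace H]

theorem denseRange_toContinuousMapOnAlgHom (a b : ℝ) :
    DenseRange (toContinuousMapOnAlgHom (R := ℝ) (Set.Icc a b)) := by
  have h := polynomialFunctions_closure_eq_top a b
  rw [DenseRange, dense_iff_closure_eq, ← polynomialFunctions_coe,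
    ← Subalgebra.topologicalClosure_coe, h]
  rfl

/-- The continuous functional calculus of an operator on a real Hilbert space: the continuous
extension of `p ↦ p(x)`. It is meaningful if `x` satisfies `HasFormBounds x a b`. -/
noncomputable def contFC (x : H →L[ℝ] H) (a b : ℝ) : C(Set.Icc a b, ℝ) →L[ℝ] (H →L[ℝ] H) :=
  (aeval x).toLinearMap.extendOfNorm (toContinuousMapOnAlgHom (R := ℝ) (Set.Icc a b)).toLinearMap

namespace HasFormBounds

variable {x : H →L[ℝ] H} {a b : ℝ} (hx : HasFormBounds x a b) (hab : a ≤ b)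

include hx hab

theorem norm_aeval_toLinearMap_le (p : ℝ[X]) : ‖(aeval x).toLinearMap p‖ ≤
    1 * ‖(toContinuousMapOnAlgHom (R := ℝ) (Set.Icc a b)).toLinearMap p‖ := by
  rw [one_mul]
  exact hx.norm_aeval_le hab p

theorem contFC_polynomial (p : ℝ[X]) :
    contFC x a b (toContinuousMapOnAlgHom (Set.Icc a b) p) = aeval x p := by
  have h := LinearMap.extendOfNorm_eq (f := (aeval x).toLinearMap)
    (e := (toContinuousMapOnAlgHom (R := ℝ) (Set.Icc a b)).toLinearMap)
    (denseRange_toContinuousMapOnAlgHom a b) ⟨1, hx.norm_aeval_toLinearMap_le hab⟩ p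
  rwa [AlgHom.toLinearMap_apply, AlgHom.toLinearMap_apply] at h

theorem norm_contFC_le (f : C(Set.Icc a b, ℝ)) : ‖contFC x a b f‖ ≤ ‖f‖ := by
  have h := LinearMap.norm_extendOfNorm_apply_le (f := (aeval x).toLinearMap)
    (e := (toContinuousMapOnAlgHom (R := ℝ) (Set.Icc a b)).toLinearMap)
    (denseRange_toContinuousMapOnAlgHom a b) 1 (hx.norm_aeval_toLinearMap_le hab) f
  rwa [one_mul] at h

theorem contFC_one : contFC x a b 1 = 1 := by
  have h := hx.contFC_polynomial hab 1
  rwa [map_one (toContinuousMapOnAlgHom _), map_one (aeval x)] at h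

theorem contFC_coord (f : C(Set.Icc a b, ℝ)) (hf : ∀ t, f t = t) : contFC x a b f = x := by
  have h := hx.contFC_polynomial hab X
  rw [aeval_X] at h
  have hfX : f = toContinuousMapOnAlgHom (Set.Icc a b) X := by
    ext t
    simp [hf]
  rw [hfX, h]

theorem contFC_mul (f g : C(Set.Icc a b, ℝ)) :
    contFC x a b (f * g) = contFC x a b f * contFC x a b g := by
  refine (denseRange_toContinuousMapOnAlgHom a b).induction_on₂
    (isClosed_eq (by fun_prop) (by fun_prop)) (fun p q => ?_) f g
  rw [← map_mul, hx.contFC_polynomial hab, hx.contFC_polynomial hab, hx.contFC_polynomial hab,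
    map_mul]

theorem isSelfAdjoint_contFC (f : C(Set.Icc a b, ℝ)) : IsSelfAdjoint (contFC x a b f) := by
  refine (denseRange_toContinuousMapOnAlgHom a b).induction_on f
    (isClosed_eq (by fun_prop) (by fun_prop)) (fun p => ?_)
  rw [hx.contFC_polynomial hab]
  exact isSelfAdjoint_aeval hx.isSelfAdjoint p

theorem commute_contFC {y : H →L[ℝ] H} (hy : Commute y x) (f : C(Set.Icc a b, ℝ)) :
    Commute y (contFC x a b f) := by
  refine (denseRange_toContinuousMapOnAlgHom a b).induction_on f
    (isClosed_eq (by fun_prop) (by fun_prop)) (fun p => ?_)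
  rw [hx.contFC_polynomial hab]
  induction p using Polynomial.induction_on' with
  | add p q hp hq => rw [map_add]; exact hp.add_right hq
  | monomial n c =>
    rw [← C_mul_X_pow_eq_monomial, ← smul_eq_C_mul, map_smul, map_pow, aeval_X]
    exact (hy.pow_right n).smul_right c

/-- A polynomial minus its constant term is a combination of positive powers. Asking only for a
closed subspace containing those powers lets Jordan algebras in as well as associative ones. -/
theorem contFC_sub_mem (S : Submodule ℝ (H →L[ℝ] H)) (hS : IsClosed (S : Set (H →L[ℝ] H)))
    (hpow : ∀ n : ℕ, x ^ (n + 1) ∈ S) (h0 : (0 : ℝ) ∈ Set.Icc a b) (f : C(Set.Icc a b, ℝ)) :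
    contFC x a b f - f ⟨0, h0⟩ • 1 ∈ S := by
  refine (denseRange_toContinuousMapOnAlgHom a b).induction_on
    (p := fun f => contFC x a b f - f ⟨0, h0⟩ • 1 ∈ S) f
    (hS.preimage (f := fun f => contFC x a b f - f ⟨0, h0⟩ • (1 : H →L[ℝ] H)) (by fun_prop))
    (fun p => ?_)
  rw [hx.contFC_polynomial hab]
  induction p using Polynomial.induction_on' with
  | add p q hp hq =>
    convert S.add_mem hp hq using 1
    simp only [map_add, ContinuousMap.add_apply, add_smul]
    abel
  | monomial n c =>
    rcases n with _ | n
    · simp [Algebra.algebraMap_eq_smul_one]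
    · rw [← C_mul_X_pow_eq_monomial, ← smul_eq_C_mul, map_smul, map_smul, map_pow, aeval_X]
      simpa using S.smul_mem c (hpow n)

theorem contFC_mem (S : Submodule ℝ (H →L[ℝ] H)) (hS : IsClosed (S : Set (H →L[ℝ] H)))
    (hpow : ∀ n : ℕ, x ^ (n + 1) ∈ S) (h0 : (0 : ℝ) ∈ Set.Icc a b) (f : C(Set.Icc a b, ℝ))
    (hf : f ⟨0, h0⟩ = 0) : contFC x a b f ∈ S := by
  simpa [hf] using hx.contFC_sub_mem hab S hS hpow h0 f

end HasFormBounds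

/-- A positive operator has a selfadjoint square root in every closed subspace that contains its
powers. -/
theorem exists_isSelfAdjoint_sqrt_mem {x : H →L[ℝ] H} (hx : x.IsPositive)
    (S : Submodule ℝ (H →L[ℝ] H)) (hS : IsClosed (S : Set (H →L[ℝ] H)))
    (hpow : ∀ n : ℕ, x ^ (n + 1) ∈ S) : ∃ y ∈ S, IsSelfAdjoint y ∧ y * y = x := by
  have hb := HasFormBounds.of_isPositive hx le_rfl
  have h0 : (0 : ℝ) ≤ ‖x‖ := norm_nonneg x
  let s : C(Set.Icc 0 ‖x‖, ℝ) := ⟨fun t => √t, by fun_prop⟩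
  refine ⟨contFC x 0 ‖x‖ s, hb.contFC_mem h0 S hS hpow ⟨le_rfl, h0⟩ s (by simp [s]),
    hb.isSelfAdjoint_contFC h0 s, ?_⟩
  rw [← hb.contFC_mul h0]
  exact hb.contFC_coord h0 _ fun t => by simp [s, Real.mul_self_sqrt t.2.1]

end ContinuousFunctionalCalculus

/-! ### Contractive maps of function algebras commute with the adjoint. -/

section ContractiveRepresentation

open scoped InnerProductSpace

variable {K : Type*} [NormedAddCommGroup K] [InnerProductSpace ℝ K] [CompleteSpace K]

theorem norm_star_clm (J : K →L[ℝ] K) : ‖star J‖ = ‖J‖ := by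
  rw [ContinuousLinearMap.star_eq_adjoint]
  exact LinearIsometryEquiv.norm_map _ _

/-- Equality case of Cauchy-Schwarz: the inner product of `J* η` with `ζ` is `‖η‖²`, while neither
vector is longer than `η`, so `‖J* η - ζ‖² ≤ 0`. -/
theorem star_apply_eq_of_contraction {J : K →L[ℝ] K} (hJ : ‖J‖ ≤ 1) {ζ η : K} (h : J ζ = η)
    (hn : ‖ζ‖ ≤ ‖η‖) : star J η = ζ := by
  have h1 : ‖star J η‖ ≤ ‖η‖ := by
    simpa using (star J).le_of_opNorm_le (c := 1) (by rwa [norm_star_clm]) η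
  have h2 : ⟪star J η, ζ⟫_ℝ = ‖η‖ ^ 2 := by
    rw [ContinuousLinearMap.star_eq_adjoint, ContinuousLinearMap.adjoint_inner_left, h,
      real_inner_self_eq_norm_sq]
  have h3 : ‖star J η - ζ‖ ^ 2 ≤ 0 := by
    rw [norm_sub_sq_real, h2]
    have := pow_le_pow_left₀ (norm_nonneg _) h1 2
    have := pow_le_pow_left₀ (norm_nonneg _) hn 2
    linarith
  exact sub_eq_zero.1 (norm_eq_zero.1 (pow_eq_zero_iff two_ne_zero |>.1
    (le_antisymm h3 (sq_nonneg _))))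

theorem star_mul_eq_of_mul_mul_eq {J F : K →L[ℝ] K} (hJ : ‖J‖ ≤ 1) (h : J * (J * F) = F) :
    star J * F = J * F := by
  ext ξ
  have h' : J (J (F ξ)) = F ξ := by simpa using congrArg (fun G : K →L[ℝ] K => G ξ) h
  exact star_apply_eq_of_contraction hJ h' (by simpa using J.le_of_opNorm_le hJ (F ξ))

theorem star_mul_eq_neg_of_mul_mul_eq_neg {J F : K →L[ℝ] K} (hJ : ‖J‖ ≤ 1)
    (h : J * (J * F) = -F) : star J * F = -(J * F) := by
  ext ξ
  have h' : J (-J (F ξ)) = F ξ := by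
    have := congrArg (fun G : K →L[ℝ] K => G ξ) h
    simp only [mul_apply_eq_comp, neg_apply] at this
    rw [map_neg, this, neg_neg]
  exact star_apply_eq_of_contraction hJ h' (by simpa using J.le_of_opNorm_le hJ (F ξ))

/-- Counting: as `c ≥ 0`, a ramp is nonzero at `s` only if `n < s`. The companion lower bound uses
that, for `c ≤ 3`, a ramp has reached 1 once `n + 1 ≤ s`. Together they put the staircase within 1
of the diagonal. -/
theorem sum_ramp_le {c : ℝ} (hc : 0 ≤ c) {s : ℝ} (hs : 0 ≤ s) (N : ℕ) :
    ∑ n ∈ Finset.range N, max 0 (min 1 (4 * (s - n) - c)) ≤ min (s + 1) N := by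
  induction N with
  | zero => simp; linarith
  | succ N ih =>
    rw [Finset.sum_range_succ]
    push_cast
    grind

theorem le_sum_ramp {c : ℝ} (hc : c ≤ 3) (s : ℝ) (N : ℕ) :
    min (s - 1) N ≤ ∑ n ∈ Finset.range N, max 0 (min 1 (4 * (s - n) - c)) := by
  induction N with
  | zero => simp
  | succ N ih =>
    rw [Finset.sum_range_succ]
    push_cast
    grind

theorem abs_sum_ramp_sub_le {c : ℝ} (hc : 0 ≤ c) (hc' : c ≤ 3) {s : ℝ} (hs : 0 ≤ s) {N : ℕ}
    (hN : s ≤ N) : |∑ n ∈ Finset.range N, max 0 (min 1 (4 * (s - n) - c)) - s| ≤ 1 := by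
  have h1 := sum_ramp_le hc hs N
  have h2 := le_sum_ramp hc' s N
  rw [abs_le]
  grind

variable {X : Type*} [TopologicalSpace X]

/-- The ramp function of slope four that climbs from `0` to `1` on
`n + c / 4 ≤ s ≤ n + (c + 1) / 4`. -/
def rampMap (s : C(X, ℝ)) (c : ℝ) (n : ℕ) : C(X, ℝ) :=
  ⟨fun t => max 0 (min 1 (4 * (s t - n) - c)), by fun_prop⟩

/-- A function vanishing on `n + 1/2 ≤ s ≤ n + 3/4` and equal to `1` at distance at least `1/4` from
that region, for all `n < N`. -/
noncomputable def cutoffMap (s : C(X, ℝ)) (N : ℕ) : C(X, ℝ) :=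
  ⟨fun t => ∏ n ∈ Finset.range N,
    max 0 (min 1 (4 * max (n + 1 / 2 - s t) (s t - n - 3 / 4))), by fun_prop⟩

theorem cutoffMap_apply (s : C(X, ℝ)) (N : ℕ) (t : X) :
    cutoffMap s N t = ∏ n ∈ Finset.range N,
      max 0 (min 1 (4 * max (n + 1 / 2 - s t) (s t - n - 3 / 4))) := rfl

theorem cutoffMap_eq_zero (s : C(X, ℝ)) {N n : ℕ} (hn : n < N) {t : X} (h1 : n + 1 / 2 ≤ s t)
    (h2 : s t ≤ n + 3 / 4) : cutoffMap s N t = 0 := by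
  refine Finset.prod_eq_zero (Finset.mem_range.2 hn) ?_
  have : max ((n : ℝ) + 1 / 2 - s t) (s t - n - 3 / 4) ≤ 0 := max_le (by linarith) (by linarith)
  exact max_eq_left ((min_le_right _ _).trans (by linarith))

theorem cutoffMap_eq_one (s : C(X, ℝ)) (N m : ℕ) {t : X} (h1 : m ≤ s t)
    (h2 : s t ≤ m + 1 / 4) : cutoffMap s N t = 1 := by
  rw [cutoffMap_apply]
  refine Finset.prod_eq_one fun n _ => ?_
  have : 1 / 4 ≤ max ((n : ℝ) + 1 / 2 - s t) (s t - n - 3 / 4) := by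
    rcases le_or_gt m n with h | h
    · have : (m : ℝ) ≤ n := by exact_mod_cast h
      exact le_max_of_le_left (by linarith)
    · have : (n : ℝ) + 1 ≤ m := by exact_mod_cast h
      exact le_max_of_le_right (by linarith)
  rw [min_eq_left (by linarith), max_eq_right zero_le_one]

theorem cutoffMap_nonneg (s : C(X, ℝ)) (N : ℕ) (t : X) : 0 ≤ cutoffMap s N t := by
  rw [cutoffMap_apply]
  exact Finset.prod_nonneg fun _ _ => le_max_left _ _

theorem cutoffMap_le_one (s : C(X, ℝ)) (N : ℕ) (t : X) : cutoffMap s N t ≤ 1 := by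
  rw [cutoffMap_apply]
  exact Finset.prod_le_one (fun _ _ => le_max_left _ _) fun _ _ =>
    max_le zero_le_one (min_le_left _ _)

variable (τ : C(X, ℝ) →ₗ[ℝ] (K →L[ℝ] K))

/-- The functions `e` for which `τ e` and its adjoint agree on the range of `F`. -/
def adjointAgree (F : K →L[ℝ] K) : Submodule ℝ C(X, ℝ) where
  carrier := {e | star (τ e) * F = τ e * F}
  add_mem' {e f} he hf := by
    simp only [Set.mem_ofPred_eq] at he hf ⊢
    rw [map_add, star_add, add_mul, add_mul, he, hf]
  zero_mem' := by simp
  smul_mem' c e he := by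
    simp only [Set.mem_ofPred_eq] at he ⊢
    rw [map_smul, star_smul, smul_mul_assoc, smul_mul_assoc, he]
    simp

theorem mem_adjointAgree {F : K →L[ℝ] K} {e : C(X, ℝ)} :
    e ∈ adjointAgree τ F ↔ star (τ e) * F = τ e * F := Iff.rfl

variable {τ} [CompactSpace X]

theorem norm_star_sub_mul_le (hτ : ∀ f, ‖τ f‖ ≤ ‖f‖) {F : K →L[ℝ] K} {e g : C(X, ℝ)}
    (hg : g ∈ adjointAgree τ F) :
    ‖(star (τ e) - τ e) * F‖ ≤ 2 * ‖e - g‖ * ‖F‖ := by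
  have h1 : (star (τ e) - τ e) * F = (star (τ (e - g)) - τ (e - g)) * F := by
    have h0 : (star (τ g) - τ g) * F = 0 := by rw [sub_mul, (mem_adjointAgree τ).1 hg, sub_self]
    rw [map_sub, star_sub, sub_sub_sub_comm, sub_mul _ (star (τ g) - τ g), h0, sub_zero]
  rw [h1]
  refine (norm_mul_le _ _).trans ?_
  gcongr
  calc ‖star (τ (e - g)) - τ (e - g)‖ ≤ ‖star (τ (e - g))‖ + ‖τ (e - g)‖ := norm_sub_le _ _
    _ ≤ ‖e - g‖ + ‖e - g‖ := by rw [norm_star_clm]; gcongr <;> exact hτ _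
    _ = _ := by ring

theorem mem_adjointAgree_of_sq_mul_eq (hτ : ∀ f, ‖τ f‖ ≤ ‖f‖) {h : C(X, ℝ)}
    (hmul : ∀ f g, τ f * τ (g * h) = τ (f * g * h)) {e f : C(X, ℝ)} (he : ‖e‖ ≤ 1)
    (hef : e * e * f = f) : e ∈ adjointAgree τ (τ (f * h)) := by
  refine star_mul_eq_of_mul_mul_eq ((hτ e).trans he) ?_
  rw [hmul, hmul, ← mul_assoc, hef]

theorem one_mem_adjointAgree (hτ : ∀ f, ‖τ f‖ ≤ ‖f‖) {h : C(X, ℝ)}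
    (hmul : ∀ f g, τ f * τ (g * h) = τ (f * g * h)) (f : C(X, ℝ)) :
    1 ∈ adjointAgree τ (τ (f * h)) :=
  mem_adjointAgree_of_sq_mul_eq hτ hmul
    ((ContinuousMap.norm_le _ zero_le_one).2 fun t => by simp) (by simp)

/-- Off its climbing interval, where `f` vanishes, the ramp is 0 or 1. So twice the ramp minus 1 has
square 1 wherever `f` is nonzero, and the ramp is a combination of it and the constant 1. -/
theorem rampMap_mem_adjointAgree (hτ : ∀ f, ‖τ f‖ ≤ ‖f‖) {h : C(X, ℝ)}
    (hmul : ∀ f g, τ f * τ (g * h) = τ (f * g * h)) {f s : C(X, ℝ)} {c : ℝ} {n : ℕ}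
    (hf : ∀ t, n + c / 4 ≤ s t → s t ≤ n + (c + 1) / 4 → f t = 0) :
    rampMap s c n ∈ adjointAgree τ (τ (f * h)) := by
  have h1 : (2 : ℝ) • rampMap s c n - 1 ∈ adjointAgree τ (τ (f * h)) := by
    refine mem_adjointAgree_of_sq_mul_eq hτ hmul
      ((ContinuousMap.norm_le _ zero_le_one).2 fun t => ?_) ?_
    · have h2 : rampMap s c n t ≤ 1 := max_le zero_le_one (min_le_left _ _)
      have h3 : 0 ≤ rampMap s c n t := le_max_left _ _
      simp only [ContinuousMap.sub_apply, ContinuousMap.smul_apply, ContinuousMap.one_apply,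
        smul_eq_mul, Real.norm_eq_abs, abs_le]
      constructor <;> linarith
    · ext t
      simp only [ContinuousMap.mul_apply, ContinuousMap.sub_apply, ContinuousMap.smul_apply,
        ContinuousMap.one_apply, smul_eq_mul]
      rcases le_or_gt (n + c / 4) (s t) with h2 | h2
      · rcases le_or_gt (s t) (n + (c + 1) / 4) with h3 | h3
        · simp [hf t h2 h3]
        · have : rampMap s c n t = 1 := by
            change max 0 (min 1 (4 * (s t - n) - c)) = 1
            rw [min_eq_left (by linarith), max_eq_right zero_le_one]
          rw [this]; ring
      · have : rampMap s c n t = 0 :=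
          max_eq_left ((min_le_right _ _).trans (by linarith))
        rw [this]; ring
  have h2 := (adjointAgree τ (τ (f * h))).smul_mem (1 / 2)
    (Submodule.add_mem _ h1 (one_mem_adjointAgree hτ hmul f))
  simpa [smul_smul] using h2

/-- The point is that the right side does not depend on `N`: stretching `v` to `N v` multiplies the
defect by `N`, yet `N v` remains within 1 of a sum of ramps with no defect. -/
theorem norm_star_sub_mul_le_of_unit_range (hτ : ∀ f, ‖τ f‖ ≤ ‖f‖) {h : C(X, ℝ)}
    (hmul : ∀ f g, τ f * τ (g * h) = τ (f * g * h)) {v : C(X, ℝ)} (hv0 : ∀ t, 0 ≤ v t)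
    (hv1 : ∀ t, v t ≤ 1) (N : ℕ) : N * ‖(star (τ v) - τ v) * τ h‖ ≤ 4 * ‖h‖ := by
  set s : C(X, ℝ) := (N : ℝ) • v with hs
  have hs0 : ∀ t, 0 ≤ s t := fun t => mul_nonneg N.cast_nonneg (hv0 t)
  have hsN : ∀ t, s t ≤ N := fun t => mul_le_of_le_one_right N.cast_nonneg (hv1 t)
  have hclose : ∀ c : ℝ, 0 ≤ c → c ≤ 3 → ‖s - ∑ n ∈ Finset.range N, rampMap s c n‖ ≤ 1 := by
    intro c hc hc'
    refine (ContinuousMap.norm_le _ zero_le_one).2 fun t => ?_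
    rw [ContinuousMap.sub_apply, ContinuousMap.sum_apply, norm_sub_rev]
    exact abs_sum_ramp_sub_le hc hc' (hs0 t) (hsN t)
  have hest : ∀ (c : ℝ) (f : C(X, ℝ)), 0 ≤ c → c ≤ 3 → ‖f‖ ≤ 1 →
      (∀ n < N, ∀ t, n + c / 4 ≤ s t → s t ≤ n + (c + 1) / 4 → f t = 0) →
      ‖(star (τ s) - τ s) * τ (f * h)‖ ≤ 2 * ‖h‖ := by
    intro c f hc hc' hf1 hf
    have hmem : ∑ n ∈ Finset.range N, rampMap s c n ∈ adjointAgree τ (τ (f * h)) :=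
      Submodule.sum_mem _ fun n hn =>
        rampMap_mem_adjointAgree hτ hmul (hf n (Finset.mem_range.1 hn))
    calc _ ≤ _ := norm_star_sub_mul_le hτ hmem
      _ ≤ 2 * 1 * ‖h‖ := by
        gcongr
        · exact hclose c hc hc'
        · refine (hτ _).trans ((norm_mul_le _ _).trans ?_)
          exact mul_le_of_le_one_left (norm_nonneg _) hf1
      _ = 2 * ‖h‖ := by ring
  -- No single family of ramps works for all of `h`. The factor `χ` vanishes where the ramps with `c
  -- = 2` climb, and `1 - χ` where those with `c = 0` climb, so each piece of `h` gets its own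
  -- family.
  set χ := cutoffMap s N with hχ
  have h1 : ‖(star (τ s) - τ s) * τ (χ * h)‖ ≤ 2 * ‖h‖ := by
    refine hest 2 χ (by norm_num) (by norm_num)
      ((ContinuousMap.norm_le _ zero_le_one).2 fun t => ?_) fun n hn t ht1 ht2 =>
        cutoffMap_eq_zero s hn (by linarith) (by linarith)
    rw [Real.norm_eq_abs, abs_of_nonneg (cutoffMap_nonneg s N t)]
    exact cutoffMap_le_one s N t
  have h2 : ‖(star (τ s) - τ s) * τ ((1 - χ) * h)‖ ≤ 2 * ‖h‖ := by
    refine hest 0 (1 - χ) le_rfl (by norm_num)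
      ((ContinuousMap.norm_le _ zero_le_one).2 fun t => ?_) fun n hn t ht1 ht2 => ?_
    · have h3 := cutoffMap_nonneg s N t
      have h4 := cutoffMap_le_one s N t
      rw [ContinuousMap.sub_apply, ContinuousMap.one_apply, Real.norm_eq_abs, abs_le]
      constructor <;> linarith
    · rw [ContinuousMap.sub_apply, hχ, cutoffMap_eq_one s N n (by linarith) (by linarith)]
      simp
  have h3 : (star (τ s) - τ s) * τ h =
      (star (τ s) - τ s) * τ (χ * h) + (star (τ s) - τ s) * τ ((1 - χ) * h) := by
    rw [← mul_add, ← map_add, ← add_mul, add_sub_cancel, one_mul]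
  have h4 : (star (τ s) - τ s) * τ h = (N : ℝ) • ((star (τ v) - τ v) * τ h) := by
    rw [hs, map_smul, star_smul, star_trivial, ← smul_sub, smul_mul_assoc]
  calc N * ‖(star (τ v) - τ v) * τ h‖ = ‖(star (τ s) - τ s) * τ h‖ := by
        rw [h4, norm_smul]; simp
    _ ≤ 2 * ‖h‖ + 2 * ‖h‖ := by rw [h3]; exact norm_add_le_of_le h1 h2
    _ = 4 * ‖h‖ := by ring

theorem star_mul_eq_of_contractive (hτ : ∀ f, ‖τ f‖ ≤ ‖f‖) {h : C(X, ℝ)}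
    (hmul : ∀ f g, τ f * τ (g * h) = τ (f * g * h)) (v : C(X, ℝ)) :
    star (τ v) * τ h = τ (v * h) := by
  have hunit : ∀ v : C(X, ℝ), (∀ t, 0 ≤ v t) → (∀ t, v t ≤ 1) → v ∈ adjointAgree τ (τ h) := by
    intro v hv0 hv1
    have h0 : (star (τ v) - τ v) * τ h = 0 := by
      by_contra hne
      have hpos := norm_pos_iff.2 hne
      obtain ⟨N, hN⟩ := exists_nat_gt (4 * ‖h‖ / ‖(star (τ v) - τ v) * τ h‖)
      rw [div_lt_iff₀ hpos] at hN
      linarith [norm_star_sub_mul_le_of_unit_range hτ hmul hv0 hv1 N]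
    rwa [sub_mul, sub_eq_zero] at h0
  have hone : (1 : C(X, ℝ)) ∈ adjointAgree τ (τ h) := by
    simpa using one_mem_adjointAgree hτ hmul 1
  have hv : v ∈ adjointAgree τ (τ h) := by
    set M := ‖v‖ + 1
    have hM : 0 < M := by positivity
    have hvt : ∀ t, |v t| ≤ M := fun t => (v.norm_coe_le_norm t).trans (by simp [M])
    -- An affine change of `v` into the range `[0, 1]`, undone by linearity.
    have h1 : (1 / (2 * M)) • (v + M • 1) ∈ adjointAgree τ (τ h) := by
      refine hunit _ (fun t => ?_) fun t => ?_ <;>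
        simp only [ContinuousMap.smul_apply, ContinuousMap.add_apply, ContinuousMap.one_apply,
          smul_eq_mul, mul_one]
      · have := (abs_le.1 (hvt t)).1
        exact mul_nonneg (by positivity) (by linarith)
      · rw [one_div_mul_eq_div, div_le_one (by positivity)]
        linarith [(abs_le.1 (hvt t)).2]
    have h2 := Submodule.sub_mem _ (Submodule.smul_mem _ (2 * M) h1) (Submodule.smul_mem _ M hone)
    rwa [smul_smul, mul_one_div_cancel (by positivity), one_smul, add_sub_cancel_right] at h2
  rw [(mem_adjointAgree τ).1 hv]
  simpa using hmul v 1

end ContractiveRepresentation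

/-! ### Contractive homomorphisms on selfadjoint elements. -/

section ContractiveHomomorphism

variable {H : Type*} [NormedAddCommGroup H] [InnerProductSpace ℝ H] [CompleteSpace H]
variable {K : Type*} [NormedAddCommGroup K] [InnerProductSpace ℝ K] [CompleteSpace K]

theorem eq_zero_of_forall_norm_le {E : Type*} [NormedAddCommGroup E] {y : E} {c : ℝ}
    (hc : 0 < c) (h : ∀ ε > 0, ‖y‖ ≤ c * ε) : y = 0 := by
  by_contra hy
  have hpos := norm_pos_iff.2 hy
  have := h (‖y‖ / (2 * c)) (by positivity)
  rw [mul_div_assoc', mul_comm 2 c, mul_div_mul_left _ _ hc.ne'] at this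
  linarith

/-- The function `|t| / ε` cut off at height one. -/
noncomputable def lowerCutoff (ε : ℝ) (s : Set ℝ) : C(s, ℝ) :=
  ⟨fun t => min 1 (|(t : ℝ)| / ε), by fun_prop⟩

/-- A function vanishing on `|t| ≤ ε` and equal to one on `2 ε ≤ |t|`. -/
noncomputable def upperCutoff (ε : ℝ) (s : Set ℝ) : C(s, ℝ) :=
  ⟨fun t => max 0 (min 1 (|(t : ℝ)| / ε - 1)), by fun_prop⟩

/-- The inclusion of a set of real numbers, as a continuous function. -/
def inclusionMap (s : Set ℝ) : C(s, ℝ) := ⟨fun t => t, by fun_prop⟩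

theorem lowerCutoff_apply (ε : ℝ) {s : Set ℝ} (t : s) :
    lowerCutoff ε s t = min 1 (|(t : ℝ)| / ε) := rfl

theorem upperCutoff_apply (ε : ℝ) {s : Set ℝ} (t : s) :
    upperCutoff ε s t = max 0 (min 1 (|(t : ℝ)| / ε - 1)) := rfl

theorem inclusionMap_apply {s : Set ℝ} (t : s) : inclusionMap s t = t := rfl

theorem norm_lowerCutoff_le {ε : ℝ} (hε : 0 < ε) (s : Set ℝ) [CompactSpace s] :
    ‖lowerCutoff ε s‖ ≤ 1 := by
  refine (ContinuousMap.norm_le _ zero_le_one).2 fun t => ?_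
  rw [lowerCutoff_apply, Real.norm_eq_abs, abs_of_nonneg (le_min zero_le_one (by positivity))]
  exact min_le_left _ _

theorem lowerCutoff_mul_upperCutoff (ε : ℝ) (s : Set ℝ) :
    lowerCutoff ε s * upperCutoff ε s = upperCutoff ε s := by
  ext t
  rw [ContinuousMap.mul_apply, lowerCutoff_apply, upperCutoff_apply]
  rcases le_total (|(t : ℝ)| / ε) 1 with h | h
  · rw [max_eq_left ((min_le_right _ _).trans (by linarith)), mul_zero]
  · rw [min_eq_left h, one_mul]

theorem norm_inclusionMap_sub_le {ε : ℝ} (hε : 0 < ε) (s : Set ℝ) [CompactSpace s] :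
    ‖inclusionMap s - upperCutoff ε s * (upperCutoff ε s * inclusionMap s)‖ ≤ 2 * ε := by
  refine (ContinuousMap.norm_le _ (by positivity)).2 fun t => ?_
  simp only [ContinuousMap.sub_apply, ContinuousMap.mul_apply, inclusionMap_apply]
  set v := upperCutoff ε s t with hv
  have h0 : 0 ≤ v := le_max_left _ _
  have h1 : v ≤ 1 := max_le zero_le_one (min_le_left _ _)
  have hvv : 0 ≤ 1 - v * v := by nlinarith
  have e : (t : ℝ) - v * (v * t) = (1 - v * v) * t := by ring
  rw [e, norm_mul, Real.norm_eq_abs, Real.norm_eq_abs, abs_of_nonneg hvv]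
  rcases le_total (|(t : ℝ)|) (2 * ε) with h | h
  · nlinarith [abs_nonneg (t : ℝ), mul_nonneg h0 h0]
  · have h2 : 2 ≤ |(t : ℝ)| / ε := by rwa [le_div_iff₀ hε]
    have : v = 1 := by
      rw [hv, upperCutoff_apply, min_eq_left (by linarith), max_eq_right zero_le_one]
    rw [this]; simp; positivity

variable {C : NonUnitalSubalgebra ℝ (H →L[ℝ] H)} {T : (H →L[ℝ] H) →ₗ[ℝ] (K →L[ℝ] K)}

omit [CompleteSpace H] in
theorem NonUnitalSubalgebra.pow_succ_mem {x : H →L[ℝ] H} (hx : x ∈ C) (n : ℕ) :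
    x ^ (n + 1) ∈ C.toSubmodule := by
  induction n with
  | zero => simpa using hx
  | succ n ih => rw [pow_succ]; exact C.mul_mem ih hx

theorem HasFormBounds.contFC_mem_nonUnitalSubalgebra {x : H →L[ℝ] H} {a b : ℝ}
    (hx : HasFormBounds x a b) (hab : a ≤ b) (hC : IsClosed (C : Set (H →L[ℝ] H))) (hxC : x ∈ C)
    (h0 : (0 : ℝ) ∈ Set.Icc a b) (f : C(Set.Icc a b, ℝ)) (hf : f ⟨0, h0⟩ = 0) :
    contFC x a b f ∈ C :=
  hx.contFC_mem hab C.toSubmodule hC (fun n => C.pow_succ_mem hxC n) h0 f hf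

/-- The constant function 1 need not give an element of `C`, so `T` is composed with multiplication
by a cutoff `κ` vanishing at 0. The resulting `τ` is contractive on all continuous functions and
multiplicative against any `h` with `κ h = h`; such functions recover `x` up to `2 ε`. -/
theorem isSelfAdjoint_map_of_contractive (hC : IsClosed (C : Set (H →L[ℝ] H)))
    (hmul : ∀ a ∈ C, ∀ b ∈ C, T (a * b) = T a * T b) (hT : ∀ a ∈ C, ‖T a‖ ≤ ‖a‖)
    {x : H →L[ℝ] H} (hxC : x ∈ C) (hx : IsSelfAdjoint x) : IsSelfAdjoint (T x) := by
  have hb := HasFormBounds.of_norm_le hx le_rfl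
  have hr : 0 ≤ ‖x‖ := norm_nonneg x
  have hab : -‖x‖ ≤ ‖x‖ := by linarith
  have h0 : (0 : ℝ) ∈ Set.Icc (-‖x‖) ‖x‖ := ⟨by linarith, hr⟩
  set s := Set.Icc (-‖x‖) ‖x‖
  have hmem : ∀ f : C(s, ℝ), f ⟨0, h0⟩ = 0 → contFC x (-‖x‖) ‖x‖ f ∈ C :=
    hb.contFC_mem_nonUnitalSubalgebra hab hC hxC h0
  refine sub_eq_zero.1 (eq_zero_of_forall_norm_le (c := 4) (by norm_num) fun ε hε => ?_)
  set κ := lowerCutoff ε s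
  have hκ0 : κ ⟨0, h0⟩ = 0 := by simp [κ, lowerCutoff_apply]
  have hκmem : ∀ f : C(s, ℝ), contFC x (-‖x‖) ‖x‖ (κ * f) ∈ C := fun f =>
    hmem _ (by rw [ContinuousMap.mul_apply, hκ0, zero_mul])
  let τ : C(s, ℝ) →ₗ[ℝ] (K →L[ℝ] K) :=
    T ∘ₗ (contFC x (-‖x‖) ‖x‖).toLinearMap ∘ₗ LinearMap.mulLeft ℝ κ
  have hτ_apply : ∀ f, τ f = T (contFC x (-‖x‖) ‖x‖ (κ * f)) := fun f => rfl
  have hτ : ∀ f, ‖τ f‖ ≤ ‖f‖ := fun f => by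
    calc ‖τ f‖ ≤ ‖contFC x (-‖x‖) ‖x‖ (κ * f)‖ := hT _ (hκmem f)
      _ ≤ ‖κ * f‖ := hb.norm_contFC_le hab _
      _ ≤ ‖κ‖ * ‖f‖ := norm_mul_le _ _
      _ ≤ ‖f‖ := mul_le_of_le_one_left (norm_nonneg _) (norm_lowerCutoff_le hε s)
  have hτmul : ∀ h, κ * h = h → ∀ f g, τ f * τ (g * h) = τ (f * g * h) := by
    intro h hh f g
    rw [hτ_apply, hτ_apply, hτ_apply, ← hmul _ (hκmem _) _ (hκmem _), ← hb.contFC_mul hab]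
    congr 2
    rw [← mul_assoc κ g h, mul_comm κ g, mul_assoc g κ h, hh, mul_assoc, mul_assoc]
  set v := upperCutoff ε s
  set w := v * inclusionMap s
  have hv : κ * v = v := lowerCutoff_mul_upperCutoff ε s
  have hw : κ * w = w := by rw [← mul_assoc, hv]
  have h1 := star_mul_eq_of_contractive hτ (hτmul v hv) w
  have h2 := star_mul_eq_of_contractive hτ (hτmul w hw) v
  -- Both orders are needed: the adjoint of `τ(v)* τ(w)` is `τ(w)* τ(v)`, and each equals `τ(v w)`.
  have hsa : star (τ (v * w)) = τ (v * w) := by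
    rw [mul_comm v w, ← h1, star_mul, star_star, h2, mul_comm v w, ← h1, h1]
  have hτvw : τ (v * w) = T (contFC x (-‖x‖) ‖x‖ (v * w)) := by
    rw [hτ_apply, ← mul_assoc, hv]
  have hdiff : x - contFC x (-‖x‖) ‖x‖ (v * w) =
      contFC x (-‖x‖) ‖x‖ (inclusionMap s - v * w) := by
    rw [map_sub, hb.contFC_coord hab (inclusionMap s) fun t => rfl]
  have hvwmem : contFC x (-‖x‖) ‖x‖ (v * w) ∈ C := by
    rw [← hv, mul_assoc]; exact hκmem _
  have hclose : ‖T x - τ (v * w)‖ ≤ 2 * ε := by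
    rw [hτvw, ← map_sub]
    refine (hT _ (C.sub_mem hxC hvwmem)).trans ?_
    rw [hdiff]
    exact (hb.norm_contFC_le hab _).trans (norm_inclusionMap_sub_le hε s)
  calc ‖star (T x) - T x‖ = ‖star (T x - τ (v * w)) - (T x - τ (v * w))‖ := by
        rw [star_sub, hsa, sub_sub_sub_cancel_right]
    _ ≤ ‖star (T x - τ (v * w))‖ + ‖T x - τ (v * w)‖ := norm_sub_le _ _
    _ ≤ 2 * ε + 2 * ε := by rw [norm_star_clm]; gcongr
    _ = 4 * ε := by ring

/-! ### Skew elements and the approximate polar decomposition. -/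

/-- The function `1 / max (√t) ε`. -/
noncomputable def invSqrtMap (ε : ℝ) (hε : 0 < ε) (s : Set ℝ) : C(s, ℝ) :=
  ⟨fun t => (max (√(t : ℝ)) ε)⁻¹, by
    refine Continuous.inv₀ (by fun_prop) fun t => (lt_max_of_lt_right hε).ne'⟩

/-- The function `max (√t - ε) 0`. -/
noncomputable def sqrtCutoff (ε : ℝ) (s : Set ℝ) : C(s, ℝ) :=
  ⟨fun t => max (√(t : ℝ) - ε) 0, by fun_prop⟩

theorem invSqrtMap_apply {ε : ℝ} (hε : 0 < ε) {s : Set ℝ} (t : s) :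
    invSqrtMap ε hε s t = (max (√(t : ℝ)) ε)⁻¹ := rfl

theorem sqrtCutoff_apply (ε : ℝ) {s : Set ℝ} (t : s) :
    sqrtCutoff ε s t = max (√(t : ℝ) - ε) 0 := rfl

variable {ε r : ℝ} (hε : 0 < ε)

theorem norm_inclusionMap_mul_invSqrtMap_sq_le :
    ‖inclusionMap (Set.Icc 0 r) *
      (invSqrtMap ε hε (Set.Icc 0 r) * invSqrtMap ε hε (Set.Icc 0 r))‖ ≤ 1 := by
  refine (ContinuousMap.norm_le _ zero_le_one).2 fun t => ?_
  simp only [ContinuousMap.mul_apply, inclusionMap_apply, invSqrtMap_apply]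
  have hm : 0 < max (√(t : ℝ)) ε := lt_max_of_lt_right hε
  rw [← mul_inv, ← div_eq_mul_inv, Real.norm_eq_abs,
    abs_of_nonneg (div_nonneg t.2.1 (by positivity)), div_le_one (by positivity)]
  nth_rewrite 1 [← Real.mul_self_sqrt t.2.1]
  gcongr <;> exact le_max_left _ _

theorem inclusionMap_mul_invSqrtMap_sq_mul_sqrtCutoff :
    inclusionMap (Set.Icc 0 r) * (invSqrtMap ε hε (Set.Icc 0 r) * (invSqrtMap ε hε (Set.Icc 0 r) *
      sqrtCutoff ε (Set.Icc 0 r))) = sqrtCutoff ε (Set.Icc 0 r) := by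
  ext t
  simp only [ContinuousMap.mul_apply, inclusionMap_apply, invSqrtMap_apply, sqrtCutoff_apply]
  rcases le_total (√(t : ℝ)) ε with h | h
  · rw [max_eq_right (sub_nonpos.2 h)]; simp
  · have ht : 0 < √(t : ℝ) := hε.trans_le h
    rw [max_eq_left h]
    nth_rewrite 1 [← Real.mul_self_sqrt t.2.1]
    field_simp

theorem norm_inclusionMap_mul_one_sub_sq_le :
    ‖inclusionMap (Set.Icc 0 r) *
      ((1 - invSqrtMap ε hε (Set.Icc 0 r) * sqrtCutoff ε (Set.Icc 0 r)) *
      (1 - invSqrtMap ε hε (Set.Icc 0 r) * sqrtCutoff ε (Set.Icc 0 r)))‖ ≤ ε ^ 2 := by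
  refine (ContinuousMap.norm_le _ (by positivity)).2 fun t => ?_
  simp only [ContinuousMap.mul_apply, inclusionMap_apply, invSqrtMap_apply, sqrtCutoff_apply,
    ContinuousMap.sub_apply, ContinuousMap.one_apply]
  rw [Real.norm_eq_abs, abs_of_nonneg (mul_nonneg t.2.1 (mul_self_nonneg _))]
  have hs := Real.mul_self_sqrt t.2.1
  rcases le_total (√(t : ℝ)) ε with h | h
  · rw [max_eq_right (sub_nonpos.2 h)]
    nlinarith [Real.sqrt_nonneg (t : ℝ)]
  · have ht : 0 < √(t : ℝ) := hε.trans_le h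
    rw [max_eq_left h, max_eq_left (sub_nonneg.2 h)]
    nth_rewrite 1 [← hs]
    apply le_of_eq
    field_simp
    ring

theorem isPositive_neg_mul_self {k : H →L[ℝ] H} (hk : star k = -k) : (-(k * k)).IsPositive := by
  have := ContinuousLinearMap.isPositive_adjoint_comp_self k
  rw [← ContinuousLinearMap.star_eq_adjoint, hk] at this
  rwa [← neg_mul]

/-- By the C*-identity the square of the norm is that of `Φ(f) k* k Φ(f)`, and `k* k = -k²` is the
operator defining the calculus. -/
theorem norm_mul_contFC_sq_le {k : H →L[ℝ] H} (hk : star k = -k) (f : C(Set.Icc 0 ‖-(k * k)‖, ℝ)) :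
    ‖k * contFC (-(k * k)) 0 ‖-(k * k)‖ f‖ ^ 2 ≤ ‖inclusionMap _ * (f * f)‖ := by
  have hb := HasFormBounds.of_isPositive (isPositive_neg_mul_self hk) le_rfl
  have h0 : 0 ≤ ‖-(k * k)‖ := norm_nonneg _
  rw [sq, ← CStarRing.norm_star_mul_self, star_mul, (hb.isSelfAdjoint_contFC h0 f).star_eq, hk]
  have h1 : contFC (-(k * k)) 0 ‖-(k * k)‖ f * -k * (k * contFC (-(k * k)) 0 ‖-(k * k)‖ f) =
      contFC (-(k * k)) 0 ‖-(k * k)‖ (f * inclusionMap _ * f) := by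
    rw [hb.contFC_mul h0, hb.contFC_mul h0, hb.contFC_coord h0 (inclusionMap _) fun t => rfl]
    noncomm_ring
  rw [h1]
  refine (hb.norm_contFC_le h0 _).trans (le_of_eq ?_)
  congr 1
  ring

/-- With `z = -k²`, the element `k Φ(h)` is a regularized phase of `k` and `Φ(f)` a truncated
modulus. The image `J` of the phase is a contraction with `J² F = -F` on the image `F` of the
modulus, so `J* F = -J F`. As `F` is selfadjoint and commutes with `J`, the product is skew, and it
lies within `ε` of `T k`. -/
theorem star_map_eq_neg_of_contractive (hC : IsClosed (C : Set (H →L[ℝ] H)))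
    (hmul : ∀ a ∈ C, ∀ b ∈ C, T (a * b) = T a * T b) (hT : ∀ a ∈ C, ‖T a‖ ≤ ‖a‖)
    {k : H →L[ℝ] H} (hkC : k ∈ C) (hk : star k = -k) : star (T k) = -T k := by
  have hb := HasFormBounds.of_isPositive (isPositive_neg_mul_self hk) le_rfl
  have hr : 0 ≤ ‖-(k * k)‖ := norm_nonneg _
  have hbound := norm_mul_contFC_sq_le hk
  have hz : ∀ y, k * (k * y) = -(-(k * k) * y) := fun y => by noncomm_ring
  set z := -(k * k) with hzdef
  set Φ := contFC z 0 ‖z‖ with hΦ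
  have hzC : z ∈ C := C.neg_mem (C.mul_mem hkC hkC)
  have h0 : (0 : ℝ) ∈ Set.Icc 0 ‖z‖ := ⟨le_rfl, hr⟩
  have hcomm : ∀ f, k * Φ f = Φ f * k := fun f =>
    hb.commute_contFC hr (((Commute.refl k).mul_right (Commute.refl k)).neg_right) f
  have hmem : ∀ f : C(Set.Icc 0 ‖z‖, ℝ), f ⟨0, h0⟩ = 0 → Φ f ∈ C :=
    hb.contFC_mem_nonUnitalSubalgebra hr hC hzC h0
  have hkmem : ∀ f : C(Set.Icc 0 ‖z‖, ℝ), k * Φ f ∈ C := fun f => by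
    -- `Φ(f)` itself may fall outside `C`; its scalar part contributes only a multiple of `k` to the
    -- product.
    have h1 := C.mul_mem hkC (hmem (f - f ⟨0, h0⟩ • 1) (by simp))
    have h2 : _ ∈ C := add_mem h1 (SMulMemClass.smul_mem (f ⟨0, h0⟩) hkC)
    rwa [map_sub, map_smul, hΦ, hb.contFC_one hr, mul_sub, mul_smul_comm, mul_one,
      sub_add_cancel] at h2
  have hzΦ : ∀ g, z * Φ g = Φ (inclusionMap _ * g) := fun g => by
    rw [hΦ, hb.contFC_mul hr, hb.contFC_coord hr (inclusionMap _) fun t => rfl]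
  rw [← add_eq_zero_iff_eq_neg]
  refine eq_zero_of_forall_norm_le (c := 2) (by norm_num) fun ε hε => ?_
  set h := invSqrtMap ε hε (Set.Icc 0 ‖z‖)
  set f := sqrtCutoff ε (Set.Icc 0 ‖z‖)
  have hfC : Φ f ∈ C := hmem f (by simp [f, sqrtCutoff_apply, hε.le])
  have hfsa : star (T (Φ f)) = T (Φ f) :=
    isSelfAdjoint_map_of_contractive hC hmul hT hfC (hb.isSelfAdjoint_contFC hr f)
  have hJ : ‖T (k * Φ h)‖ ≤ 1 := by
    refine (hT _ (hkmem h)).trans ?_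
    refine abs_le_of_sq_le_sq' ?_ zero_le_one |>.2
    rw [one_pow]
    exact (hbound h).trans (norm_inclusionMap_mul_invSqrtMap_sq_le hε)
  have hJF : T (k * Φ h) * T (Φ f) = T (k * Φ (h * f)) := by
    rw [← hmul _ (hkmem h) _ hfC, mul_assoc, ← hb.contFC_mul hr]
  have hJJF : T (k * Φ h) * (T (k * Φ h) * T (Φ f)) = -T (Φ f) := by
    rw [hJF, ← hmul _ (hkmem h) _ (hkmem _), ← map_neg]
    congr 1
    rw [mul_assoc, ← mul_assoc (Φ h), ← hcomm, mul_assoc, ← hb.contFC_mul hr, hz, hzΦ,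
      inclusionMap_mul_invSqrtMap_sq_mul_sqrtCutoff]
  have hskew : star (T (k * Φ (h * f))) = -T (k * Φ (h * f)) := by
    have h1 : T (k * Φ (h * f)) = T (Φ f) * T (k * Φ h) := by
      rw [← hmul _ hfC _ (hkmem h), ← mul_assoc, ← hcomm, mul_assoc, ← hb.contFC_mul hr,
        mul_comm f h]
    rw [h1, star_mul, hfsa, star_mul_eq_neg_of_mul_mul_eq_neg hJ hJJF, hJF, ← h1]
  have hclose : ‖T k - T (k * Φ (h * f))‖ ≤ ε := by
    rw [← map_sub]
    refine (hT _ (C.sub_mem hkC (hkmem _))).trans ?_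
    have h1 : k - k * Φ (h * f) = k * Φ (1 - h * f) := by
      rw [map_sub, hΦ, hb.contFC_one hr, mul_sub, mul_one]
    rw [h1]
    exact abs_le_of_sq_le_sq' ((hbound _).trans (norm_inclusionMap_mul_one_sub_sq_le hε)) hε.le |>.2
  calc ‖star (T k) + T k‖ = ‖star (T k - T (k * Φ (h * f))) + (T k - T (k * Φ (h * f)))‖ := by
        rw [star_sub, hskew]; congr 1; abel
    _ ≤ ‖star (T k - T (k * Φ (h * f)))‖ + ‖T k - T (k * Φ (h * f))‖ := norm_add_le _ _
    _ ≤ ε + ε := by rw [norm_star_clm]; gcongr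
    _ = 2 * ε := by ring

theorem exists_isSelfAdjoint_add_skew (a : H →L[ℝ] H) :
    ((1 / 2 : ℝ) • (a + star a)) + ((1 / 2 : ℝ) • (a - star a)) = a ∧
      IsSelfAdjoint ((1 / 2 : ℝ) • (a + star a)) ∧
      star ((1 / 2 : ℝ) • (a - star a)) = -((1 / 2 : ℝ) • (a - star a)) := by
  refine ⟨?_, ?_, ?_⟩
  · rw [← smul_add, add_add_sub_cancel, ← two_smul ℝ a, smul_smul]; norm_num
  · rw [IsSelfAdjoint, star_smul, star_add, star_star, add_comm, star_trivial]
  · rw [star_smul, star_sub, star_star, star_trivial, ← smul_neg, neg_sub]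

end ContractiveHomomorphism

/-! ### Jordan homomorphisms: reduction to singly generated algebras. -/

section JordanHomomorphism

open Polynomial
open scoped InnerProductSpace

variable {H : Type*} [NormedAddCommGroup H] [InnerProductSpace ℝ H] [CompleteSpace H]
variable {K : Type*} [NormedAddCommGroup K] [InnerProductSpace ℝ K] [CompleteSpace K]

variable {A : RealJCStarAlgebra H} {T : (H →L[ℝ] H) →ₗ[ℝ] (K →L[ℝ] K)}

theorem pow_succ_succ_eq_jordan {R : Type*} [Ring R] [Algebra ℝ R] (a : R) (n : ℕ) :
    a ^ (n + 1 + 1) = (1 / 2 : ℝ) • (a ^ (n + 1) * a + a * a ^ (n + 1)) := by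
  rw [← pow_succ, ← pow_succ', ← two_smul ℝ, smul_smul]; norm_num

theorem RealJCStarAlgebra.isClosed (A : RealJCStarAlgebra H) :
    IsClosed (A.toSubmodule : Set (H →L[ℝ] H)) := A.isClosed'

theorem RealJCStarAlgebra.pow_succ_mem {a : H →L[ℝ] H} (ha : a ∈ A) (n : ℕ) :
    a ^ (n + 1) ∈ A := by
  induction n with
  | zero => simpa using ha
  | succ n ih =>
    rw [pow_succ_succ_eq_jordan]
    exact SMulMemClass.smul_mem _ (A.jordan_mem ih ha)

theorem RealJCStarAlgebra.aeval_X_mul_mem {a : H →L[ℝ] H} (ha : a ∈ A) (p : ℝ[X]) :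
    aeval a (X * p) ∈ A := by
  induction p using Polynomial.induction_on' with
  | add p q hp hq => rw [mul_add, map_add]; exact add_mem hp hq
  | monomial n c =>
    rw [← C_mul_X_pow_eq_monomial, ← smul_eq_C_mul, mul_smul_comm, ← pow_succ', map_smul, map_pow,
      aeval_X]
    exact SMulMemClass.smul_mem _ (A.pow_succ_mem ha n)

omit [CompleteSpace H] in
theorem exists_aeval_of_mem_adjoin_singleton {a y : H →L[ℝ] H}
    (hy : y ∈ NonUnitalAlgebra.adjoin ℝ {a}) : ∃ p : ℝ[X], y = aeval a (X * p) := by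
  induction hy using NonUnitalAlgebra.adjoin_induction with
  | mem y hy => exact ⟨1, by simpa using hy⟩
  | add y z _ _ hy hz =>
    obtain ⟨p, rfl⟩ := hy
    obtain ⟨q, rfl⟩ := hz
    exact ⟨p + q, by rw [mul_add, map_add]⟩
  | zero => exact ⟨0, by simp⟩
  | mul y z _ _ hy hz =>
    obtain ⟨p, rfl⟩ := hy
    obtain ⟨q, rfl⟩ := hz
    exact ⟨p * (X * q), by rw [← map_mul, mul_assoc]⟩
  | smul c y _ hy =>
    obtain ⟨p, rfl⟩ := hy
    exact ⟨c • p, by rw [mul_smul_comm, map_smul]⟩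

theorem RealJCStarAlgebra.closure_adjoin_subset {a : H →L[ℝ] H} (ha : a ∈ A) {y : H →L[ℝ] H}
    (hy : y ∈ closure (NonUnitalAlgebra.adjoin ℝ {a} : Set (H →L[ℝ] H))) : y ∈ A := by
  refine closure_minimal (fun z hz => ?_) A.isClosed' hy
  obtain ⟨p, rfl⟩ := exists_aeval_of_mem_adjoin_singleton hz
  exact A.aeval_X_mul_mem ha p

theorem norm_mul_self_of_isSelfAdjoint {b : H →L[ℝ] H} (hb : IsSelfAdjoint b) :
    ‖b * b‖ = ‖b‖ * ‖b‖ := by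
  nth_rewrite 1 [← hb.star_eq]
  exact CStarRing.norm_star_mul_self

theorem norm_mul_self_of_skew {b : H →L[ℝ] H} (hb : star b = -b) : ‖b * b‖ = ‖b‖ * ‖b‖ := by
  rw [← CStarRing.norm_star_mul_self, hb, neg_mul, norm_neg]

theorem inner_smul_sq_sub_pow_four {b : H →L[ℝ] H} (hb : IsSelfAdjoint b) (r : ℝ) (ξ : H) :
    ⟪(r • (b * b) - b * b * (b * b)) ξ, ξ⟫_ℝ = r * ‖b ξ‖ ^ 2 - ‖b (b ξ)‖ ^ 2 := by
  simp only [sub_apply, smul_apply, mul_apply_eq_comp, inner_sub_left, real_inner_smul_left]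
  rw [isSelfAdjoint_inner_comm hb (b ξ), real_inner_self_eq_norm_sq,
    isSelfAdjoint_inner_comm hb (b (b (b ξ))), isSelfAdjoint_inner_comm hb (b (b ξ)),
    real_inner_self_eq_norm_sq]

/-- A substitute for `r² - b² ≥ 0` that needs no unit: the form at `ξ` is `r²‖bξ‖² - ‖b²ξ‖²`, whence
`‖b‖² = ‖b²‖ ≤ r‖b‖`. -/
theorem norm_le_of_isPositive_smul_sq_sub {b : H →L[ℝ] H} (hb : IsSelfAdjoint b) {r : ℝ}
    (hr : 0 ≤ r) (hpos : (r ^ 2 • (b * b) - b * b * (b * b)).IsPositive) : ‖b‖ ≤ r := by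
  have h1 : ‖b * b‖ ≤ r * ‖b‖ := by
    refine ContinuousLinearMap.opNorm_le_bound _ (by positivity) fun ξ => ?_
    have h2 := hpos.inner_nonneg_left ξ
    rw [inner_smul_sq_sub_pow_four hb, sub_nonneg, ← mul_pow] at h2
    have h3 : ‖b (b ξ)‖ ≤ r * ‖b ξ‖ := abs_le_of_sq_le_sq' h2 (by positivity) |>.2
    calc ‖(b * b) ξ‖ ≤ r * ‖b ξ‖ := h3
      _ ≤ r * (‖b‖ * ‖ξ‖) := by gcongr; exact b.le_opNorm ξ
      _ = r * ‖b‖ * ‖ξ‖ := by ring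
  rw [norm_mul_self_of_isSelfAdjoint hb] at h1
  rcases (norm_nonneg b).eq_or_lt with h0 | h0
  · rwa [← h0]
  · exact le_of_mul_le_mul_right h1 h0

theorem isPositive_norm_sq_smul_sq_sub {b : H →L[ℝ] H} (hb : IsSelfAdjoint b) :
    (‖b‖ ^ 2 • (b * b) - b * b * (b * b)).IsPositive := by
  have h2 : IsSelfAdjoint (b * b) := by simpa [pow_two] using hb.pow 2
  have h4 : IsSelfAdjoint (b * b * (b * b)) := by simpa [pow_two] using h2.pow 2
  refine (ContinuousLinearMap.isPositive_iff' _).2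
    ⟨((IsSelfAdjoint.all (‖b‖ ^ 2)).smul h2).sub h4, fun ξ => ?_⟩
  rw [inner_smul_sq_sub_pow_four hb, sub_nonneg, ← mul_pow]
  gcongr
  exact b.le_opNorm _

theorem norm_pow_three_le (a : H →L[ℝ] H) : ‖a * star a * a‖ ≤ ‖a‖ ^ 3 := by
  calc ‖a * star a * a‖ ≤ ‖a‖ * ‖star a‖ * ‖a‖ :=
        (norm_mul_le _ _).trans (by gcongr; exact norm_mul_le _ _)
    _ = ‖a‖ ^ 3 := by rw [norm_star_clm]; ring

/-- The C*-identity used twice: `‖a‖⁴ = ‖(a* a)²‖ = ‖a* (a a* a)‖`. -/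
theorem pow_three_norm_le (a : H →L[ℝ] H) : ‖a‖ ^ 3 ≤ ‖a * star a * a‖ := by
  have hsa : IsSelfAdjoint (star a * a) := IsSelfAdjoint.star_mul_self a
  have h1 : ‖a‖ ^ 3 * ‖a‖ ≤ ‖a * star a * a‖ * ‖a‖ := by
    calc ‖a‖ ^ 3 * ‖a‖ = ‖star a * a * (star a * a)‖ := by
          have h2 : ‖star a * a‖ = ‖a‖ * ‖a‖ := CStarRing.norm_star_mul_self
          rw [norm_mul_self_of_isSelfAdjoint hsa, h2]; ring
      _ = ‖star a * (a * star a * a)‖ := by simp only [mul_assoc]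
      _ ≤ ‖a * star a * a‖ * ‖a‖ := by
          rw [mul_comm, ← norm_star_clm a]; exact norm_mul_le _ _
  rcases (norm_nonneg a).eq_or_lt with h0 | h0
  · rw [← h0]; simp
  · exact le_of_mul_le_mul_right h1 h0

theorem triple_eq_jordan {R : Type*} [Ring R] [Algebra ℝ R] (a c : R) :
    a * c * a = (1 / 2 : ℝ) • ((a * c + c * a) * a + a * (a * c + c * a) -
      (a * a * c + c * (a * a))) := by
  have h : (a * c + c * a) * a + a * (a * c + c * a) - (a * a * c + c * (a * a)) =
      (2 : ℝ) • (a * c * a) := by rw [two_smul]; noncomm_ring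
  rw [h, smul_smul]; norm_num

/-- Arbitrarily large exponents suffice, since the triple product only reaches powers of 3. -/
theorem le_of_forall_pow_le_mul {x y : ℝ} (hy : 0 ≤ y) {c : ℝ}
    (h : ∀ n : ℕ, ∃ m ≥ n, x ^ m ≤ c * y ^ m) : x ≤ y := by
  by_contra! hlt
  rcases hy.eq_or_lt with rfl | hy0
  · obtain ⟨m, hm, h1⟩ := h 1
    rw [zero_pow (by omega), mul_zero] at h1
    exact absurd h1 (not_le.2 (pow_pos hlt m))
  · obtain ⟨n, hn⟩ := pow_unbounded_of_one_lt c ((one_lt_div hy0).2 hlt)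
    obtain ⟨m, hm, h1⟩ := h n
    have h2 : (x / y) ^ n ≤ (x / y) ^ m := pow_le_pow_right₀ ((one_lt_div hy0).2 hlt).le hm
    have h3 : (x / y) ^ m ≤ c := by rwa [div_pow, div_le_iff₀ (by positivity)]
    linarith

variable (hJ : ∀ a ∈ A, ∀ b ∈ A, T (a * b + b * a) = T a * T b + T b * T a)

include hJ

omit [CompleteSpace K] in
theorem map_pow_succ_of_jordan {a : H →L[ℝ] H} (ha : a ∈ A) (n : ℕ) :
    T (a ^ (n + 1)) = T a ^ (n + 1) := by
  induction n with
  | zero => simp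
  | succ n ih =>
    rw [pow_succ_succ_eq_jordan, pow_succ_succ_eq_jordan, map_smul,
      hJ _ (A.pow_succ_mem ha n) _ ha, ih]

omit [CompleteSpace K] in
theorem map_mul_self_of_jordan {a : H →L[ℝ] H} (ha : a ∈ A) : T (a * a) = T a * T a := by
  simpa [pow_two] using map_pow_succ_of_jordan hJ ha 1

omit [CompleteSpace K] in
theorem map_aeval_of_jordan {a : H →L[ℝ] H} (ha : a ∈ A) (p : ℝ[X]) :
    T (aeval a (X * p)) = aeval (T a) (X * p) := by
  induction p using Polynomial.induction_on' with
  | add p q hp hq => rw [mul_add, map_add, map_add, hp, hq, map_add]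
  | monomial n c =>
    rw [← C_mul_X_pow_eq_monomial, ← smul_eq_C_mul, mul_smul_comm, ← pow_succ', map_smul, map_smul,
      map_smul, map_pow (aeval a), map_pow (aeval (T a)), aeval_X, aeval_X,
      map_pow_succ_of_jordan hJ ha]

omit [CompleteSpace K] in
-- Preservation of powers settles polynomials in `a` without constant term; contractivity carries
-- the identity to limits.
theorem map_mul_of_mem_closure_adjoin (hT : ∀ a ∈ A, ‖T a‖ ≤ ‖a‖) {a y z : H →L[ℝ] H} (ha : a ∈ A)
    (hy : y ∈ closure (NonUnitalAlgebra.adjoin ℝ {a} : Set (H →L[ℝ] H)))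
    (hz : z ∈ closure (NonUnitalAlgebra.adjoin ℝ {a} : Set (H →L[ℝ] H))) :
    T (y * z) = T y * T z := by
  have hcont : ∀ (u : ℕ → (H →L[ℝ] H)) (w : H →L[ℝ] H), (∀ n, u n ∈ A) → w ∈ A →
      Filter.Tendsto u Filter.atTop (nhds w) →
      Filter.Tendsto (fun n => T (u n)) Filter.atTop (nhds (T w)) := by
    intro u w hu hw h
    rw [tendsto_iff_norm_sub_tendsto_zero] at h ⊢
    refine squeeze_zero (fun _ => norm_nonneg _) (fun n => ?_) h
    rw [← map_sub]
    exact hT _ (sub_mem (hu n) hw)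
  obtain ⟨u, hu, hul⟩ := mem_closure_iff_seq_limit.1 hy
  obtain ⟨v, hv, hvl⟩ := mem_closure_iff_seq_limit.1 hz
  have hsub : ∀ w ∈ NonUnitalAlgebra.adjoin ℝ {a}, w ∈ A := fun w hw =>
    A.closure_adjoin_subset ha (subset_closure hw)
  have hyz : y * z ∈ A := A.closure_adjoin_subset ha
    (mul_mem (S := NonUnitalSubalgebra ℝ (H →L[ℝ] H))
      (s := (NonUnitalAlgebra.adjoin ℝ {a}).topologicalClosure) hy hz)
  have h1 := hcont _ _ (fun n => hsub _ (mul_mem (hu n) (hv n))) hyz (hul.mul hvl)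
  have h2 := (hcont u y (fun n => hsub _ (hu n)) (A.closure_adjoin_subset ha hy) hul).mul
    (hcont v z (fun n => hsub _ (hv n)) (A.closure_adjoin_subset ha hz) hvl)
  refine tendsto_nhds_unique h1 (h2.congr fun n => ?_)
  obtain ⟨p, hp⟩ := exists_aeval_of_mem_adjoin_singleton (hu n)
  obtain ⟨q, hq⟩ := exists_aeval_of_mem_adjoin_singleton (hv n)
  have hpq : aeval a (X * p) * aeval a (X * q) = aeval a (X * (p * (X * q))) := by
    rw [← map_mul, mul_assoc]
  rw [hp, hq, hpq, map_aeval_of_jordan hJ ha, map_aeval_of_jordan hJ ha, map_aeval_of_jordan hJ ha,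
    ← map_mul, mul_assoc]

theorem map_star_of_contractive_jordan (hT : ∀ a ∈ A, ‖T a‖ ≤ ‖a‖) {a : H →L[ℝ] H} (ha : a ∈ A) :
    T (star a) = star (T a) := by
  have hclosed : ∀ b : H →L[ℝ] H,
      IsClosed ((NonUnitalAlgebra.adjoin ℝ {b}).topologicalClosure : Set (H →L[ℝ] H)) :=
    fun b => NonUnitalSubalgebra.isClosed_topologicalClosure _
  have hself : ∀ b : H →L[ℝ] H, b ∈ (NonUnitalAlgebra.adjoin ℝ {b}).topologicalClosure :=
    fun b => subset_closure (NonUnitalAlgebra.self_mem_adjoin_singleton ℝ b)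
  have hmem : ∀ b ∈ A, ∀ y ∈ (NonUnitalAlgebra.adjoin ℝ {b}).topologicalClosure, ‖T y‖ ≤ ‖y‖ :=
    fun b hb y hy => hT y (A.closure_adjoin_subset hb hy)
  obtain ⟨hdecomp, hs, hk⟩ := exists_isSelfAdjoint_add_skew a
  set s := (1 / 2 : ℝ) • (a + star a)
  set k := (1 / 2 : ℝ) • (a - star a)
  have hsA : s ∈ A := SMulMemClass.smul_mem _ (add_mem ha (star_mem ha))
  have hkA : k ∈ A := SMulMemClass.smul_mem _ (sub_mem ha (star_mem ha))
  have h1 : star (T s) = T s := isSelfAdjoint_map_of_contractive (hclosed s)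
    (fun y hy z hz => map_mul_of_mem_closure_adjoin hJ hT hsA hy hz) (hmem s hsA) (hself s) hs
  have h2 : star (T k) = -T k := star_map_eq_neg_of_contractive (hclosed k)
    (fun y hy z hz => map_mul_of_mem_closure_adjoin hJ hT hkA hy hz) (hmem k hkA) (hself k) hk
  rw [← hdecomp, star_add, hs.star_eq, hk, map_add, map_add, star_add, h1, h2, map_neg]

/-! ### Selfadjoint Jordan homomorphisms: positivity and contractivity. -/

variable (hstar : ∀ a ∈ A, T (star a) = star (T a))

include hstar

theorem isPositive_map_of_jordan_star {a : H →L[ℝ] H} (ha : a ∈ A) (hpos : a.IsPositive) :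
    (T a).IsPositive := by
  obtain ⟨y, hy, hysa, rfl⟩ := exists_isSelfAdjoint_sqrt_mem hpos A.toSubmodule A.isClosed
    fun n => A.pow_succ_mem ha n
  have h1 : star (T y) = T y := by rw [← hstar y hy, hysa.star_eq]
  have h2 := ContinuousLinearMap.isPositive_adjoint_comp_self (T y)
  rw [← ContinuousLinearMap.star_eq_adjoint, h1] at h2
  rw [map_mul_self_of_jordan hJ hy]
  exact h2

theorem norm_map_le_of_isSelfAdjoint {x : H →L[ℝ] H} (hx : x ∈ A) (hsa : IsSelfAdjoint x) :
    ‖T x‖ ≤ ‖x‖ := by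
  have hxx : x * x ∈ A := A.sq_mem' hx
  have hmem : ‖x‖ ^ 2 • (x * x) - x * x * (x * x) ∈ A :=
    sub_mem (SMulMemClass.smul_mem _ hxx) (A.sq_mem' hxx)
  have hpos := isPositive_map_of_jordan_star hJ hstar hmem (isPositive_norm_sq_smul_sq_sub hsa)
  rw [map_sub, map_smul, map_mul_self_of_jordan hJ hxx, map_mul_self_of_jordan hJ hx] at hpos
  have hTsa : IsSelfAdjoint (T x) := by rw [IsSelfAdjoint, ← hstar x hx, hsa.star_eq]
  exact norm_le_of_isPositive_smul_sq_sub hTsa (norm_nonneg x) hpos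

theorem norm_map_le_of_skew {k : H →L[ℝ] H} (hk : k ∈ A) (hskew : star k = -k) :
    ‖T k‖ ≤ ‖k‖ := by
  have hTskew : star (T k) = -T k := by rw [← hstar k hk, hskew, map_neg]
  have hsa : IsSelfAdjoint (k * k) := by rw [IsSelfAdjoint, star_mul, hskew, neg_mul_neg]
  have h1 := norm_map_le_of_isSelfAdjoint hJ hstar (A.sq_mem' hk) hsa
  rw [map_mul_self_of_jordan hJ hk, norm_mul_self_of_skew hTskew, norm_mul_self_of_skew hskew]
    at h1
  exact abs_le_of_sq_le_sq' (by simpa [pow_two] using h1) (norm_nonneg k) |>.2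

theorem norm_map_le_two_mul {a : H →L[ℝ] H} (ha : a ∈ A) : ‖T a‖ ≤ 2 * ‖a‖ := by
  obtain ⟨hdecomp, hs, hk⟩ := exists_isSelfAdjoint_add_skew a
  have h1 := norm_map_le_of_isSelfAdjoint hJ hstar
    (SMulMemClass.smul_mem (1 / 2 : ℝ) (add_mem ha (star_mem ha))) hs
  have h2 := norm_map_le_of_skew hJ hstar
    (SMulMemClass.smul_mem (1 / 2 : ℝ) (sub_mem ha (star_mem ha))) hk
  have h3 : ‖(1 / 2 : ℝ) • (a + star a)‖ ≤ ‖a‖ := by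
    rw [norm_smul, Real.norm_of_nonneg (by norm_num)]
    have := norm_add_le a (star a)
    rw [norm_star_clm] at this
    linarith
  have h4 : ‖(1 / 2 : ℝ) • (a - star a)‖ ≤ ‖a‖ := by
    rw [norm_smul, Real.norm_of_nonneg (by norm_num)]
    have := norm_sub_le a (star a)
    rw [norm_star_clm] at this
    linarith
  rw [← hdecomp, map_add, hdecomp]
  linarith [norm_add_le (T ((1 / 2 : ℝ) • (a + star a))) (T ((1 / 2 : ℝ) • (a - star a)))]

theorem triple_mem_and_map_triple {a : H →L[ℝ] H} (ha : a ∈ A) :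
    a * star a * a ∈ A ∧ T (a * star a * a) = T a * star (T a) * T a := by
  have hs : star a ∈ A := star_mem ha
  have h1 := A.jordan_mem ha hs
  have h2 : a * a ∈ A := A.sq_mem' ha
  refine ⟨?_, ?_⟩
  · rw [triple_eq_jordan]
    exact SMulMemClass.smul_mem _ (sub_mem (A.jordan_mem h1 ha) (A.jordan_mem h2 hs))
  · rw [triple_eq_jordan, triple_eq_jordan, map_smul, map_sub, hJ _ h1 _ ha, hJ _ h2 _ hs,
      hJ _ ha _ hs, map_mul_self_of_jordan hJ ha, hstar a ha]

/-- The triple product `a a* a` is a Jordan expression in `a` and `a*`, so `T` preserves it.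
Replacing `a` by it cubes both norms while the constant stays 2. -/
theorem norm_map_pow_le {a : H →L[ℝ] H} (ha : a ∈ A) (n : ℕ) :
    ‖T a‖ ^ 3 ^ n ≤ 2 * ‖a‖ ^ 3 ^ n := by
  induction n generalizing a with
  | zero => simpa using norm_map_le_two_mul hJ hstar ha
  | succ n ih =>
    obtain ⟨h1, h2⟩ := triple_mem_and_map_triple hJ hstar ha
    rw [pow_succ', pow_mul, pow_mul]
    calc (‖T a‖ ^ 3) ^ 3 ^ n ≤ ‖T (a * star a * a)‖ ^ 3 ^ n := by
          gcongr; rw [h2]; exact pow_three_norm_le (T a)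
      _ ≤ 2 * ‖a * star a * a‖ ^ 3 ^ n := ih h1
      _ ≤ 2 * (‖a‖ ^ 3) ^ 3 ^ n := by gcongr; exact norm_pow_three_le a

theorem norm_map_le_of_jordan_star {a : H →L[ℝ] H} (ha : a ∈ A) : ‖T a‖ ≤ ‖a‖ :=
  le_of_forall_pow_le_mul (norm_nonneg _) fun n =>
    ⟨3 ^ n, (Nat.lt_pow_self (by norm_num)).le, norm_map_pow_le hJ hstar ha n⟩

end JordanHomomorphism

/-! ### Operator matrices and entrywise amplification. -/

section Amplification

open scoped InnerProductSpace

variable {H : Type*} [NormedAddCommGroup H] [InnerProductSpace ℝ H]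
variable {K : Type*} [NormedAddCommGroup K] [InnerProductSpace ℝ K]
variable {n : ℕ}

/-- The inclusion of the `j`-th summand of `H^n`. -/
noncomputable def singleCLM (H : Type*) [NormedAddCommGroup H] [InnerProductSpace ℝ H] {n : ℕ}
    (j : Fin n) : H →L[ℝ] PiLp 2 (fun _ : Fin n => H) :=
  ((PiLp.continuousLinearEquiv 2 ℝ (fun _ : Fin n => H)).symm :
      (∀ _ : Fin n, H) →L[ℝ] PiLp 2 (fun _ : Fin n => H)) ∘L
    ContinuousLinearMap.single ℝ (fun _ : Fin n => H) j

theorem singleCLM_apply (j i : Fin n) (ξ : H) :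
    singleCLM H j ξ i = if i = j then ξ else 0 := by
  simp only [singleCLM, ContinuousLinearMap.comp_apply]
  exact Pi.single_apply j ξ i

theorem sum_singleCLM (ξ : PiLp 2 (fun _ : Fin n => H)) : ∑ j, singleCLM H j (ξ j) = ξ := by
  ext i
  simp [singleCLM_apply]

/-- The `(i, j)` entry of an operator on `H^n`. -/
noncomputable def operatorEntry (i j : Fin n)
    (X : PiLp 2 (fun _ : Fin n => H) →L[ℝ] PiLp 2 (fun _ : Fin n => H)) : H →L[ℝ] H :=
  PiLp.proj 2 (fun _ : Fin n => H) i ∘L X ∘L singleCLM H j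

theorem operatorEntry_apply (i j : Fin n)
    (X : PiLp 2 (fun _ : Fin n => H) →L[ℝ] PiLp 2 (fun _ : Fin n => H)) (ξ : H) :
    operatorEntry i j X ξ = X (singleCLM H j ξ) i := rfl

theorem continuous_operatorEntry (i j : Fin n) :
    Continuous (operatorEntry (H := H) i j) := by
  unfold operatorEntry
  fun_prop

theorem matrixOperator_operatorEntry
    (X : PiLp 2 (fun _ : Fin n => H) →L[ℝ] PiLp 2 (fun _ : Fin n => H)) :
    matrixOperator (Matrix.of fun i j => operatorEntry i j X) = X := by
  ext ξ i
  rw [matrixOperator_apply]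
  conv_rhs => rw [← sum_singleCLM ξ, map_sum]
  simp [operatorEntry_apply]

theorem operatorEntry_matrixOperator (M : Matrix (Fin n) (Fin n) (H →L[ℝ] H)) (i j : Fin n) :
    operatorEntry i j (matrixOperator M) = M i j := by
  ext ξ
  rw [operatorEntry_apply, matrixOperator_apply, Finset.sum_eq_single j]
  · simp [singleCLM_apply]
  · intro b _ hb
    simp [singleCLM_apply, hb]
  · simp

theorem matrixOperator_mul (M N : Matrix (Fin n) (Fin n) (H →L[ℝ] H)) :
    matrixOperator M * matrixOperator N = matrixOperator (M * N) := by
  ext ξ i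
  simp only [mul_apply_eq_comp, matrixOperator_apply, Matrix.mul_apply, map_sum, sum_apply]
  exact Finset.sum_comm

theorem matrixOperator_add (M N : Matrix (Fin n) (Fin n) (H →L[ℝ] H)) :
    matrixOperator (M + N) = matrixOperator M + matrixOperator N := by
  ext ξ i
  simp [matrixOperator_apply, Finset.sum_add_distrib]

theorem matrixOperator_smul (c : ℝ) (M : Matrix (Fin n) (Fin n) (H →L[ℝ] H)) :
    matrixOperator (c • M) = c • matrixOperator M := by
  ext ξ i
  simp [matrixOperator_apply, Finset.smul_sum]

theorem operatorEntry_add (i j : Fin n)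
    (X Y : PiLp 2 (fun _ : Fin n => H) →L[ℝ] PiLp 2 (fun _ : Fin n => H)) :
    operatorEntry i j (X + Y) = operatorEntry i j X + operatorEntry i j Y := by
  ext ξ
  simp [operatorEntry_apply]

theorem operatorEntry_smul (i j : Fin n) (c : ℝ)
    (X : PiLp 2 (fun _ : Fin n => H) →L[ℝ] PiLp 2 (fun _ : Fin n => H)) :
    operatorEntry i j (c • X) = c • operatorEntry i j X := by
  ext ξ
  simp [operatorEntry_apply]

theorem operatorEntry_zero (i j : Fin n) : operatorEntry (H := H) i j 0 = 0 := by
  ext ξ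
  simp [operatorEntry_apply]

theorem operatorEntry_mul (i j : Fin n)
    (X Y : PiLp 2 (fun _ : Fin n => H) →L[ℝ] PiLp 2 (fun _ : Fin n => H)) :
    operatorEntry i j (X * Y) = ∑ l, operatorEntry i l X * operatorEntry l j Y := by
  conv_lhs => rw [← matrixOperator_operatorEntry X, ← matrixOperator_operatorEntry Y,
    matrixOperator_mul, operatorEntry_matrixOperator]
  rfl

/-- The entrywise amplification of a linear map between spaces of operators. -/
noncomputable def amplification (n : ℕ) (T : (H →L[ℝ] H) →ₗ[ℝ] (K →L[ℝ] K)) :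
    (PiLp 2 (fun _ : Fin n => H) →L[ℝ] PiLp 2 (fun _ : Fin n => H)) →ₗ[ℝ]
      (PiLp 2 (fun _ : Fin n => K) →L[ℝ] PiLp 2 (fun _ : Fin n => K)) where
  toFun X := matrixOperator (Matrix.of fun i j => T (operatorEntry i j X))
  map_add' X Y := by
    rw [← matrixOperator_add]
    congr 1
    ext1 i j
    simp only [Matrix.of_apply, Matrix.add_apply, operatorEntry_add, map_add]
  map_smul' c X := by
    rw [RingHom.id_apply, ← matrixOperator_smul]
    congr 1
    ext1 i j
    simp only [Matrix.of_apply, Matrix.smul_apply, operatorEntry_smul, map_smul]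

theorem amplification_apply (T : (H →L[ℝ] H) →ₗ[ℝ] (K →L[ℝ] K))
    (X : PiLp 2 (fun _ : Fin n => H) →L[ℝ] PiLp 2 (fun _ : Fin n => H)) :
    amplification n T X = matrixOperator (Matrix.of fun i j => T (operatorEntry i j X)) := rfl

theorem amplification_matrixOperator (T : (H →L[ℝ] H) →ₗ[ℝ] (K →L[ℝ] K))
    (M : Matrix (Fin n) (Fin n) (H →L[ℝ] H)) :
    amplification n T (matrixOperator M) = matrixOperator (M.map T) := by
  rw [amplification_apply]
  congr 1
  ext1 i j
  rw [Matrix.of_apply, operatorEntry_matrixOperator]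
  rfl

variable [CompleteSpace H] [CompleteSpace K]

theorem star_matrixOperator (M : Matrix (Fin n) (Fin n) (H →L[ℝ] H)) :
    star (matrixOperator M) = matrixOperator (Matrix.of fun i j => star (M j i)) := by
  rw [ContinuousLinearMap.star_eq_adjoint]
  symm
  rw [ContinuousLinearMap.eq_adjoint_iff]
  intro ξ η
  simp only [PiLp.inner_apply, matrixOperator_apply, sum_inner, inner_sum, Matrix.of_apply,
    ContinuousLinearMap.star_eq_adjoint, ContinuousLinearMap.adjoint_inner_left]
  exact Finset.sum_comm

theorem operatorEntry_star (i j : Fin n)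
    (X : PiLp 2 (fun _ : Fin n => H) →L[ℝ] PiLp 2 (fun _ : Fin n => H)) :
    operatorEntry i j (star X) = star (operatorEntry j i X) := by
  conv_lhs => rw [← matrixOperator_operatorEntry X, star_matrixOperator,
    operatorEntry_matrixOperator]
  rfl

/-- A real C*-algebra of operators, regarded as a real JC*-algebra. -/
def NonUnitalStarSubalgebra.toRealJCStarAlgebra (A : NonUnitalStarSubalgebra ℝ (H →L[ℝ] H))
    (hA : IsClosed (A : Set (H →L[ℝ] H))) : RealJCStarAlgebra H where
  toSubmodule := A.toSubmodule
  isClosed' := hA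
  star_mem' ha := A.star_mem' ha
  sq_mem' ha := A.mul_mem' ha ha

/-- The operators on `H^n` with all entries in a real C*-algebra on `H`. -/
noncomputable def matrixJCStarAlgebra (A : NonUnitalStarSubalgebra ℝ (H →L[ℝ] H))
    (hA : IsClosed (A : Set (H →L[ℝ] H))) (n : ℕ) :
    RealJCStarAlgebra (PiLp 2 (fun _ : Fin n => H)) where
  carrier := {X | ∀ i j, operatorEntry i j X ∈ A}
  add_mem' hX hY i j := by rw [operatorEntry_add]; exact add_mem (hX i j) (hY i j)
  zero_mem' i j := by rw [operatorEntry_zero]; exact zero_mem A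
  smul_mem' c X hX i j := by
    rw [operatorEntry_smul]; exact SMulMemClass.smul_mem c (hX i j)
  isClosed' := by
    have h : IsClosed (⋂ i, ⋂ j, operatorEntry (H := H) (n := n) i j ⁻¹' A) :=
      isClosed_iInter fun i => isClosed_iInter fun j => hA.preimage (continuous_operatorEntry i j)
    convert h
    ext X
    simp
  star_mem' hX i j := by rw [operatorEntry_star]; exact star_mem (hX j i)
  sq_mem' hX i j := by
    rw [operatorEntry_mul]; exact sum_mem fun l _ => mul_mem (hX i l) (hX l j)

variable {A : NonUnitalStarSubalgebra ℝ (H →L[ℝ] H)} {hA : IsClosed (A : Set (H →L[ℝ] H))}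
  {T : (H →L[ℝ] H) →ₗ[ℝ] (K →L[ℝ] K)}

theorem matrixOperator_mem_matrixJCStarAlgebra (M : Matrix (Fin n) (Fin n) A) :
    matrixOperator (M.map fun a => (a : H →L[ℝ] H)) ∈ matrixJCStarAlgebra A hA n := fun i j => by
  rw [operatorEntry_matrixOperator]; exact (M i j).2

omit [CompleteSpace K] in
theorem amplification_mul (hmul : ∀ a ∈ A, ∀ b ∈ A, T (a * b) = T a * T b)
    {X Y : PiLp 2 (fun _ : Fin n => H) →L[ℝ] PiLp 2 (fun _ : Fin n => H)}
    (hX : X ∈ matrixJCStarAlgebra A hA n) (hY : Y ∈ matrixJCStarAlgebra A hA n) :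
    amplification n T (X * Y) = amplification n T X * amplification n T Y := by
  rw [amplification_apply, amplification_apply, amplification_apply, matrixOperator_mul]
  congr 1
  ext1 i j
  rw [Matrix.of_apply, operatorEntry_mul, map_sum, Matrix.mul_apply]
  exact Finset.sum_congr rfl fun l _ => hmul _ (hX i l) _ (hY l j)

theorem amplification_star (hstar : ∀ a ∈ A, T (star a) = star (T a))
    {X : PiLp 2 (fun _ : Fin n => H) →L[ℝ] PiLp 2 (fun _ : Fin n => H)}
    (hX : X ∈ matrixJCStarAlgebra A hA n) :
    amplification n T (star X) = star (amplification n T X) := by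
  rw [amplification_apply, amplification_apply, star_matrixOperator]
  congr 1
  ext1 i j
  rw [Matrix.of_apply, operatorEntry_star, hstar _ (hX j i)]
  rfl

omit [CompleteSpace K] in
theorem amplification_jordan (hmul : ∀ a ∈ A, ∀ b ∈ A, T (a * b) = T a * T b) :
    ∀ X ∈ matrixJCStarAlgebra A hA n, ∀ Y ∈ matrixJCStarAlgebra A hA n,
      amplification n T (X * Y + Y * X) =
        amplification n T X * amplification n T Y + amplification n T Y * amplification n T X :=
  fun X hX Y hY => by rw [map_add, amplification_mul hmul hX hY, amplification_mul hmul hY hX]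

end Amplification

/-- Replaces a map between subspaces of operators by one defined on every operator, avoiding
subtypes. The extension is purely algebraic and need not be bounded; it is only controlled on the
original subspace. -/
theorem LinearMap.exists_extend_of_injective {V M E : Type*} [AddCommGroup V] [Module ℝ V]
    [AddCommGroup M] [Module ℝ M] [AddCommGroup E] [Module ℝ E] (ι : M →ₗ[ℝ] V)
    (hι : Function.Injective ι) (f : M →ₗ[ℝ] E) : ∃ g : V →ₗ[ℝ] E, ∀ m, g (ι m) = f m := by
  obtain ⟨r, hr⟩ := ι.exists_leftInverse_of_injective (LinearMap.ker_eq_bot.2 hι)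
  exact ⟨f ∘ₗ r, fun m => congrArg f (LinearMap.congr_fun hr m)⟩

/-! ### Assembly of the two parts. -/

section Main

variable {H : Type*} [NormedAddCommGroup H] [InnerProductSpace ℝ H] [CompleteSpace H]
variable {K : Type*} [NormedAddCommGroup K] [InnerProductSpace ℝ K] [CompleteSpace K]

theorem jordanHom_contractive_iff_selfadjoint {A : RealJCStarAlgebra H} {B : RealJCStarAlgebra K}
    (T : A →ₗ[ℝ] B) (hT : IsJordanHom T) :
    (IsContractiveMap T ↔ IsSelfadjointMap T) ∧ (IsSelfadjointMap T → IsPositiveMap T) := by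
  let ιA : A →ₗ[ℝ] (H →L[ℝ] H) := ⟨⟨fun a => a, fun _ _ => rfl⟩, fun _ _ => rfl⟩
  let ιB : B →ₗ[ℝ] (K →L[ℝ] K) := ⟨⟨fun a => a, fun _ _ => rfl⟩, fun _ _ => rfl⟩
  obtain ⟨g, hg⟩ := ιA.exists_extend_of_injective Subtype.val_injective (ιB ∘ₗ T)
  have hg' : ∀ a : A, g (a : H →L[ℝ] H) = (T a : K →L[ℝ] K) := hg
  have hJ : ∀ a ∈ A, ∀ b ∈ A, g (a * b + b * a) = g a * g b + g b * g a := by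
    intro a ha b hb
    have h1 := hg' (RealJCStarAlgebra.jordan ⟨a, ha⟩ ⟨b, hb⟩)
    rw [hT] at h1
    rw [hg' ⟨a, ha⟩, hg' ⟨b, hb⟩]
    exact h1
  have hsa : IsSelfadjointMap T → ∀ a ∈ A, g (star a) = star (g a) := fun h a ha => by
    rw [hg' ⟨a, ha⟩]
    exact (hg' (star ⟨a, ha⟩)).trans (congrArg Subtype.val (h ⟨a, ha⟩))
  refine ⟨⟨fun hc a => Subtype.ext ?_, fun h a => ?_⟩, fun h a ha => ?_⟩
  · have h1 := map_star_of_contractive_jordan hJ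
      (fun a ha => by rw [hg' ⟨a, ha⟩]; exact hc ⟨a, ha⟩) a.2
    rw [hg' a] at h1
    exact (hg' (star a)).symm.trans h1
  · rw [← hg' a]
    exact norm_map_le_of_jordan_star hJ (hsa h) a.2
  · rw [← hg' a]
    exact isPositive_map_of_jordan_star hJ (hsa h) a.2 ha

theorem hom_contractive_iff_selfadjoint {A : NonUnitalStarSubalgebra ℝ (H →L[ℝ] H)}
    {B : NonUnitalStarSubalgebra ℝ (K →L[ℝ] K)} (hA : IsClosed (A : Set (H →L[ℝ] H)))
    (π : A →ₙₐ[ℝ] B) :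
    (IsContractiveMap π ↔ IsSelfadjointMap π) ∧
      (IsSelfadjointMap π → IsPositiveMap π ∧ IsCompletelyPositiveMap π ∧
        IsCompletelyContractiveMap π) := by
  let ιA : A →ₗ[ℝ] (H →L[ℝ] H) := ⟨⟨fun a => a, fun _ _ => rfl⟩, fun _ _ => rfl⟩
  let ιB : B →ₗ[ℝ] (K →L[ℝ] K) := ⟨⟨fun a => a, fun _ _ => rfl⟩, fun _ _ => rfl⟩
  obtain ⟨g, hg⟩ := ιA.exists_extend_of_injective Subtype.val_injective
    (ιB ∘ₗ ⟨⟨π, map_add π⟩, map_smul π⟩)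
  have hg' : ∀ a : A, g (a : H →L[ℝ] H) = (π a : K →L[ℝ] K) := hg
  have hmul : ∀ a ∈ A, ∀ b ∈ A, g (a * b) = g a * g b := by
    intro a ha b hb
    have h1 := hg' (⟨a, ha⟩ * ⟨b, hb⟩)
    rw [map_mul] at h1
    rw [hg' ⟨a, ha⟩, hg' ⟨b, hb⟩]
    exact h1
  have hJ : ∀ a ∈ A.toRealJCStarAlgebra hA, ∀ b ∈ A.toRealJCStarAlgebra hA,
      g (a * b + b * a) = g a * g b + g b * g a := fun a ha b hb => by
    rw [map_add, hmul a ha b hb, hmul b hb a ha]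
  have hsa : IsSelfadjointMap π → ∀ a ∈ A, g (star a) = star (g a) := fun h a ha => by
    rw [hg' ⟨a, ha⟩]
    exact (hg' (star ⟨a, ha⟩)).trans (congrArg Subtype.val (h ⟨a, ha⟩))
  have hampl : ∀ (n : ℕ) (M : Matrix (Fin n) (Fin n) A),
      matrixOperator (M.map fun a => (π a : K →L[ℝ] K)) =
        amplification n g (matrixOperator (M.map fun a => (a : H →L[ℝ] H))) := fun n M => by
    rw [amplification_matrixOperator]
    congr 1
    ext1 i j
    exact (hg' (M i j)).symm
  refine ⟨⟨fun hc a => Subtype.ext ?_, fun h a => ?_⟩, fun h =>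
    ⟨fun a ha => ?_, fun n M hM => ?_, fun n M => ?_⟩⟩
  · have h1 := map_star_of_contractive_jordan hJ
      (fun a ha => by rw [hg' ⟨a, ha⟩]; exact hc ⟨a, ha⟩) (a := a) a.2
    rw [hg' a] at h1
    exact (hg' (star a)).symm.trans h1
  · rw [← hg' a]
    exact norm_map_le_of_jordan_star hJ (hsa h) (a := a) a.2
  · rw [← hg' a]
    exact isPositive_map_of_jordan_star hJ (hsa h) (a := a) a.2 ha
  · rw [hampl]
    -- The amplification is a selfadjoint Jordan homomorphism on `M_n(A)`, so the case of a single
    -- algebra, now over `H^n`, applies unchanged.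
    exact isPositive_map_of_jordan_star (A := matrixJCStarAlgebra A hA n)
      (amplification_jordan hmul) (fun X hX => amplification_star (hsa h) hX)
      (matrixOperator_mem_matrixJCStarAlgebra M) hM
  · rw [hampl]
    exact norm_map_le_of_jordan_star (A := matrixJCStarAlgebra A hA n)
      (amplification_jordan hmul) (fun X hX => amplification_star (hsa h) hX)
      (matrixOperator_mem_matrixJCStarAlgebra M)

end Main

theorem mainTheorem4
    {H : Type*} [NormedAddCommGroup H] [InnerProductSpace ℝ H] [CompleteSpace H]
    {K : Type*} [NormedAddCommGroup K] [InnerProductSpace ℝ K] [CompleteSpace K] :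
    -- homomorphisms between real C*-algebras
    (∀ (A : NonUnitalStarSubalgebra ℝ (H →L[ℝ] H)) (B : NonUnitalStarSubalgebra ℝ (K →L[ℝ] K)),
      IsClosed (A : Set (H →L[ℝ] H)) → IsClosed (B : Set (K →L[ℝ] K)) →
      ∀ π : A →ₙₐ[ℝ] B,
        (IsContractiveMap π ↔ IsSelfadjointMap π) ∧
        (IsContractiveMap π →
          (∃ ψ : A →⋆ₙₐ[ℝ] B, ∀ a, ψ a = π a) ∧
          IsPositiveMap π ∧ IsCompletelyPositiveMap π ∧ IsCompletelyContractiveMap π)) ∧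
    -- Jordan homomorphisms between real JC*-algebras
    (∀ (A : RealJCStarAlgebra H) (B : RealJCStarAlgebra K) (T : A →ₗ[ℝ] B), IsJordanHom T →
        (IsContractiveMap T ↔ IsSelfadjointMap T) ∧
        (IsContractiveMap T → IsJordanStarHom T ∧ IsPositiveMap T)) := by
  refine ⟨fun A B hA _ π => ?_, fun A B T hT => ?_⟩
  · obtain ⟨h1, h2⟩ := hom_contractive_iff_selfadjoint hA π
    exact ⟨h1, fun hc => ⟨⟨{ π with map_star' := h1.1 hc }, fun _ => rfl⟩, h2 (h1.1 hc)⟩⟩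
  · obtain ⟨h1, h2⟩ := jordanHom_contractive_iff_selfadjoint T hT
    exact ⟨h1, fun hc => ⟨⟨hT, h1.1 hc⟩, h2 (h1.1 hc)⟩⟩
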